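/- Let $n\ge 2$. An interval exchange transformation $\varphi=\varphi(\lambda,\pi,\varepsilon)$ of $n$ intervals (flips allowed) is given by positive lengths $\lambda_1,\dots,\lambda_n$ with $\lambda_1+\dots+\lambda_n=1$, a permutation $\pi$ of $\{1,\dots,n\}$ and signs $\varepsilon_i=\pm1$. Put $\beta_0=0$, $\beta_i=\lambda_1+\dots+\lambda_i$, $v_i=[\beta_{i-1},\beta_i)$ and $\gamma_i=\sum_{k<\pi(i)}\lambda_{\pi^{-1}(k)}$; for $x\in v_i$ put $\varphi(x)=x-\beta_{i-1}+\gamma_i$ if $\varepsilon_i=1$ and $\varphi(x)=\beta_i-x+\gamma_i$ if $\varepsilon_i=-1$. A Borel probability measure $\mu$ on $[0,1)$ is invariant if $\mu(\varphi^{-1}(A))=\mu(A)$ for all Borel sets $A$ and, in case some $\varepsilon_i=-1$ (so that $\varphi$ is a bijection only off the finite set of endpoints), $\mu(\{\beta_i\})=0$ for $0\le i<n$. The transformation $\varphi$ is called strictly (uniquely) ergodic if it has exactly one invariant Borel probability measure. Let $\mathcal O_\lambda$ be the unital $C^*$-algebra of operators on $L^2([0,1])$ generated by the unitary $u(\zeta)=\zeta\circ\varphi^{-1}$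 and by the operators of multiplication by the characteristic functions $\chi_{v_1},\dots,\chi_{v_n}$. Let $(K_0,K_0^+,[1])$ be its $K_0$-group (the Grothendieck group of the semigroup of Murray-von Neumann classes of projections in matrix algebras over $\mathcal O_\lambda$), with the positive cone formed by the classes of projections and with the class of the unit as order unit. A Bratteli diagram of $\varphi$ is a sequence $P_1,P_2,P_3,\dots$ of $n\times n$ matrices with non-negative integer entries, together with a vector $d\in\mathbb Z_{\ge0}^n$, such that $(K_0,K_0^+,[1])$ is isomorphic, as an ordered group with order unit, to the inductive limit of $$\mathbb Z^n\xrightarrow{P_1}\mathbb Z^n\xrightarrow{P_2}\mathbb Z^n\xrightarrow{P_3}\cdots,$$ where $\mathbb Z^n$ is ordered coordinatewise, the matrices act on row vectors, and the order unit is the image of the vector $d$ at the first level. The transformation $\varphi$ is called stationary if it has a Bratteli diagram whose sequence of matrices can be divided into consecutive finite non-empty blocks $P_m,P_{m+1},\dots,P_{m+k}$ whose products $P_mP_{m+1}\cdots P_{m+k}$ are all equal to one and the same matrix $P$ with strictly positive entries. Theorem. Every stationary interval exchange transformation of $n\ge2$ intervals is strictly (uniquely) ergodic. -/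

import Mathlib

open MeasureTheory

/-! ### Interval exchange transformations -/

/-- Data `(λ, π, ε)` of an interval exchange transformation of `n` intervals (with flips):
positive lengths of total sum one, a permutation, and a vector of signs. -/
structure IntervalExchange (n : ℕ) where
  len : Fin n → ℝ
  len_pos : ∀ i, 0 < len i
  sum_len : ∑ i, len i = 1
  perm : Equiv.Perm (Fin n)
  sign : Fin n → ℤˣ

namespace IntervalExchange

/-- The left endpoint of the `i`-th interval when intervals of lengths `l 0, l 1, …` are laid
side by side from left to right, starting at `0`. -/
noncomputable def start {n : ℕ} (l : Fin n → ℝ) (i : Fin n) : ℝ :=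
  ∑ j ∈ Finset.Iio i, l j

/-- The left endpoint of the `i`-th interval. -/
noncomputable def left {n : ℕ} (T : IntervalExchange n) (i : Fin n) : ℝ :=
  start T.len i

/-- The left endpoint of the image of the `i`-th interval, which is put at place `π i`. -/
noncomputable def imageLeft {n : ℕ} (T : IntervalExchange n) (i : Fin n) : ℝ :=
  start (fun k => T.len (T.perm.symm k)) (T.perm i)

/-- The `i`-th interval of the partition of `[0, 1)`. -/
def interval {n : ℕ} (T : IntervalExchange n) (i : Fin n) : Set ℝ :=
  Set.Ico (T.left i) (T.left i + T.len i)

/-- The isometry by which the `i`-th interval is moved: a translation if `ε i = 1`,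
a reflection if `ε i = -1`. -/
noncomputable def piece {n : ℕ} (T : IntervalExchange n) (i : Fin n) (x : ℝ) : ℝ :=
  if T.sign i = 1 then x - T.left i + T.imageLeft i
  else T.left i + T.len i - x + T.imageLeft i

open Classical in
/-- The transformation `φ`. It is the `i`-th isometry on the `i`-th interval; it matters on
`[0, 1)` only, and is given the value `0` elsewhere. -/
noncomputable def toFun {n : ℕ} (T : IntervalExchange n) (x : ℝ) : ℝ :=
  ∑ i, if x ∈ T.interval i then T.piece i x else 0

/-- The unit interval `[0, 1)` with Lebesgue measure. -/
noncomputable def lebesgue : Measure ℝ := volume.restrict (Set.Ico 0 1)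

/-! #### Lebesgue measure is invariant -/

theorem start_tiling {n : ℕ} (l : Fin n → ℝ) (hl : ∀ i, 0 < l i) :
    (⋃ i, Set.Ico (start l i) (start l i + l i)) = Set.Ico 0 (∑ i, l i) ∧
      Pairwise (fun i j => Disjoint (Set.Ico (start l i) (start l i + l i))
        (Set.Ico (start l j) (start l j + l j))) := by
  induction n with
  | zero =>
    refine ⟨by simp, fun i => i.elim0⟩
  | succ n ih =>
    obtain ⟨h1, h2⟩ := ih (fun i => l i.castSucc) (fun i => hl _)
    have hs : ∀ i : Fin n, start l i.castSucc = start (fun i => l i.castSucc) i := by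
      intro i
      simp [start, ← Fin.map_castSuccEmb_Iio, Finset.sum_map]
    have hlast : start l (Fin.last n) = ∑ i : Fin n, l i.castSucc := by
      have : Finset.Iio (Fin.last n) = Finset.univ.map Fin.castSuccEmb := by
        ext j
        constructor
        · intro hj
          simp only [Finset.mem_Iio] at hj
          exact Finset.mem_map.2 ⟨j.castPred hj.ne, by simp, by simp⟩
        · simp only [Finset.mem_map, Finset.mem_Iio]
          rintro ⟨i, -, rfl⟩
          exact Fin.castSucc_lt_last i
      rw [start, this, Finset.sum_map]
      rfl
    have hnn : (0 : ℝ) ≤ ∑ i : Fin n, l i.castSucc := Finset.sum_nonneg fun i _ => (hl _).le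
    have hdl : ∀ i : Fin n, Disjoint (Set.Ico (start l i.castSucc)
        (start l i.castSucc + l i.castSucc))
        (Set.Ico (start l (Fin.last n)) (start l (Fin.last n) + l (Fin.last n))) := by
      intro i
      rw [hlast, Set.disjoint_left]
      intro x hx hx'
      rw [hs] at hx
      have : x ∈ Set.Ico (0 : ℝ) (∑ i : Fin n, l i.castSucc) := by
        rw [← h1]
        exact Set.mem_iUnion.2 ⟨i, hx⟩
      exact absurd this.2 (not_lt.2 hx'.1)
    constructor
    · have key : (⋃ i : Fin (n + 1), Set.Ico (start l i) (start l i + l i)) =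
          (⋃ i : Fin n, Set.Ico (start l i.castSucc) (start l i.castSucc + l i.castSucc)) ∪
            Set.Ico (start l (Fin.last n)) (start l (Fin.last n) + l (Fin.last n)) := by
        ext x
        simp only [Set.mem_iUnion, Set.mem_union, Fin.exists_fin_succ']
      rw [key, Fin.sum_univ_castSucc, hlast]
      simp only [hs]
      rw [h1, Set.Ico_union_Ico_eq_Ico hnn]
      linarith [hl (Fin.last n)]
    · intro i j hij
      induction i using Fin.lastCases with
      | last =>
        induction j using Fin.lastCases with
        | last => exact absurd rfl hij
        | cast j => exact (hdl j).symm
      | cast i =>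
        induction j using Fin.lastCases with
        | last => exact hdl i
        | cast j =>
          simp only [hs]
          exact h2 fun h => hij (by rw [h])

theorem restrict_tiling {n : ℕ} (l : Fin n → ℝ) (hl : ∀ i, 0 < l i) (h1 : ∑ i, l i = 1) :
    lebesgue = Measure.sum fun i =>
      (volume : Measure ℝ).restrict (Set.Ico (start l i) (start l i + l i)) := by
  obtain ⟨h, h'⟩ := start_tiling l hl
  rw [lebesgue, ← h1, ← h, Measure.restrict_iUnion h' fun i => measurableSet_Ico]

theorem toFun_eq {n : ℕ} (T : IntervalExchange n) (i : Fin n) {x : ℝ} (hx : x ∈ T.interval i) :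
    T.toFun x = T.piece i x := by
  rw [toFun, Finset.sum_eq_single i]
  · rw [if_pos hx]
  · intro j _ hj
    rw [if_neg]
    intro hxj
    exact Set.disjoint_left.1 ((start_tiling T.len T.len_pos).2 hj) hxj hx
  · intro h
    exact absurd (Finset.mem_univ i) h

theorem measurable_piece {n : ℕ} (T : IntervalExchange n) (i : Fin n) :
    Measurable (T.piece i) := by
  unfold piece
  split_ifs <;> fun_prop

theorem measurable_toFun {n : ℕ} (T : IntervalExchange n) : Measurable T.toFun :=
  Finset.measurable_fun_sum _ fun i _ =>
    Measurable.ite measurableSet_Ico (T.measurable_piece i) measurable_const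

theorem map_piece {n : ℕ} (T : IntervalExchange n) (i : Fin n) :
    ((volume : Measure ℝ).restrict (T.interval i)).map (T.piece i) =
      (volume : Measure ℝ).restrict (Set.Ico (T.imageLeft i) (T.imageLeft i + T.len i)) := by
  by_cases h : T.sign i = 1
  · have hp : T.piece i = fun x => x + (T.imageLeft i - T.left i) := by
      funext x
      rw [piece, if_pos h]
      ring
    have hm : MeasurePreserving (T.piece i) volume volume := by
      rw [hp]
      exact measurePreserving_add_right volume _
    have hpre : T.piece i ⁻¹' (Set.Ico (T.imageLeft i) (T.imageLeft i + T.len i)) =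
        T.interval i := by
      ext x
      simp only [hp, interval, Set.mem_preimage, Set.mem_Ico]
      constructor <;> rintro ⟨_, _⟩ <;> constructor <;> linarith
    rw [← hpre]
    exact (hm.restrict_preimage measurableSet_Ico).map_eq
  · have hp : T.piece i = fun x => (T.left i + T.len i + T.imageLeft i) - x := by
      funext x
      rw [piece, if_neg h]
      ring
    have hm : MeasurePreserving (T.piece i) volume volume := by
      rw [hp]
      exact Measure.measurePreserving_sub_left volume _
    have hpre : T.piece i ⁻¹' (Set.Ioc (T.imageLeft i) (T.imageLeft i + T.len i)) =
        T.interval i := by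
      ext x
      simp only [hp, interval, Set.mem_preimage, Set.mem_Ico, Set.mem_Ioc]
      constructor <;> rintro ⟨_, _⟩ <;> constructor <;> linarith
    rw [← hpre, Measure.restrict_congr_set Ico_ae_eq_Ioc]
    exact (hm.restrict_preimage measurableSet_Ioc).map_eq

/-- An interval exchange transformation preserves Lebesgue measure on `[0, 1)`. -/
theorem measurePreserving {n : ℕ} (T : IntervalExchange n) :
    MeasurePreserving T.toFun lebesgue lebesgue := by
  refine ⟨T.measurable_toFun, ?_⟩
  have e1 : lebesgue = Measure.sum fun i => (volume : Measure ℝ).restrict (T.interval i) :=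
    restrict_tiling T.len T.len_pos T.sum_len
  have e2 : lebesgue = Measure.sum fun i =>
      (volume : Measure ℝ).restrict (Set.Ico (T.imageLeft i) (T.imageLeft i + T.len i)) := by
    rw [restrict_tiling (fun k => T.len (T.perm.symm k)) (fun i => T.len_pos _)
      (by rw [← T.sum_len]; exact Equiv.sum_comp T.perm.symm T.len)]
    rw [← Measure.sum_comp_equiv T.perm]
    simp [imageLeft]
  conv_lhs => rw [e1]
  rw [Measure.map_sum T.measurable_toFun.aemeasurable, e2]
  congr 1
  funext i
  rw [← T.map_piece i]
  refine Measure.map_congr ?_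
  filter_upwards [ae_restrict_mem (measurableSet_Ico :
    MeasurableSet (Set.Ico (T.left i) (T.left i + T.len i)))] with x hx
  exact T.toFun_eq i hx

/-! #### Invariant measures and strict ergodicity -/

/-- Invariance of a measure on `[0, 1)`. If some interval is flipped, `φ` is a bijection only
off the finite set of endpoints of the intervals, where the choice of its values is a mere
convention; then the invariant measures are those that do not charge this set. -/
structure IsInvariant {n : ℕ} (T : IntervalExchange n) (μ : Measure ℝ) : Prop where
  carrier : μ (Set.Ico 0 1)ᶜ = 0
  preserving : MeasurePreserving T.toFun μ μ
  endpoints : (∃ i, T.sign i = -1) → ∀ i, μ {T.left i} = 0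

/-- Strict (unique) ergodicity: there is exactly one invariant Borel probability measure. -/
def StrictlyErgodic {n : ℕ} (T : IntervalExchange n) : Prop :=
  ∃! μ : Measure ℝ, IsProbabilityMeasure μ ∧ T.IsInvariant μ

/-! #### The C*-algebra of an interval exchange transformation -/

/-- The Hilbert space `L²([0, 1])`. -/
abbrev Hilbert : Type := Lp ℂ 2 lebesgue

/-- The isometry `ζ ↦ ζ ∘ φ` of `L²([0, 1])`. -/
noncomputable def koopman {n : ℕ} (T : IntervalExchange n) : Hilbert →L[ℂ] Hilbert :=
  (Lp.compMeasurePreservingₗᵢ ℂ T.toFun T.measurePreserving).toContinuousLinearMap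

/-- The unitary operator `u(ζ) = ζ ∘ φ⁻¹`, that is, the inverse (equivalently, the adjoint) of
the unitary operator `ζ ↦ ζ ∘ φ`. -/
noncomputable def unitaryOp {n : ℕ} (T : IntervalExchange n) : Hilbert →L[ℂ] Hilbert :=
  ContinuousLinearMap.adjoint T.koopman

theorem unitaryOp_comp {n : ℕ} (T : IntervalExchange n) (ζ : Hilbert) :
    T.unitaryOp (Lp.compMeasurePreserving T.toFun T.measurePreserving ζ) = ζ := by
  have h : (ContinuousLinearMap.adjoint T.koopman) ∘L T.koopman = ContinuousLinearMap.id ℂ _ :=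
    (ContinuousLinearMap.norm_map_iff_adjoint_comp_self T.koopman).1
      (Lp.norm_compMeasurePreserving · T.measurePreserving)
  exact congrArg (fun S : Hilbert →L[ℂ] Hilbert => S ζ) h

/-- The operator of multiplication by the characteristic function of the `i`-th interval. -/
noncomputable def charOp {n : ℕ} (T : IntervalExchange n) (i : Fin n) : Hilbert →L[ℂ] Hilbert :=
  (ContinuousLinearMap.mul ℂ ℂ).holderL lebesgue ⊤ 2 2
    (indicatorConstLp ⊤ (measurableSet_Ico : MeasurableSet (T.interval i))
      (measure_ne_top_of_subset (Set.subset_univ _) (by simp [lebesgue])) 1)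

theorem charOp_apply {n : ℕ} (T : IntervalExchange n) (i : Fin n) (ζ : Hilbert) :
    T.charOp i ζ =ᵐ[lebesgue] (T.interval i).indicator ζ := by
  refine (ContinuousLinearMap.coeFn_holder (r := 2) (ContinuousLinearMap.mul ℂ ℂ) _ ζ).trans ?_
  filter_upwards [indicatorConstLp_coeFn (p := ⊤) (μ := lebesgue) (c := (1 : ℂ))
    (hs := (measurableSet_Ico : MeasurableSet (T.interval i)))
    (hμs := measure_ne_top_of_subset (Set.subset_univ _) (by simp [lebesgue]))] with x hx
  rw [hx]
  change (T.interval i).indicator (fun _ => (1 : ℂ)) x * ζ x = _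
  by_cases h : x ∈ T.interval i <;> simp [h]

/-- The C*-algebra of `T`: the norm closed unital `*`-algebra of operators on `L²([0, 1])`
generated by `u` and the characteristic operators of the intervals. -/
noncomputable def cstarAlgebra {n : ℕ} (T : IntervalExchange n) :
    StarSubalgebra ℂ (Hilbert →L[ℂ] Hilbert) :=
  (StarAlgebra.adjoin ℂ (insert T.unitaryOp (Set.range T.charOp))).topologicalClosure

end IntervalExchange

/-! ### The group `K₀` -/

/-- A projection in some matrix algebra over `A`. -/
structure MatrixProjection (A : Type*) [Ring A] [StarRing A] where
  size : ℕ
  mat : Matrix (Fin size) (Fin size) A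
  isProj : IsStarProjection mat

namespace MatrixProjection

variable {A : Type*} [Ring A] [StarRing A]

open Matrix

/-- Murray–von Neumann equivalence of projections: `p = v v*` and `q = v* v` for some (possibly
rectangular) matrix `v`. -/
def Equivalent (p q : MatrixProjection A) : Prop :=
  ∃ v : Matrix (Fin p.size) (Fin q.size) A, v * vᴴ = p.mat ∧ vᴴ * v = q.mat

theorem Equivalent.refl (p : MatrixProjection A) : Equivalent p p := by
  have h1 : p.matᴴ = p.mat := p.isProj.isSelfAdjoint
  have h2 : p.mat * p.mat = p.mat := p.isProj.isIdempotentElem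
  exact ⟨p.mat, by rw [h1, h2], by rw [h1, h2]⟩

theorem Equivalent.symm {p q : MatrixProjection A} (h : Equivalent p q) : Equivalent q p := by
  obtain ⟨v, h1, h2⟩ := h
  exact ⟨vᴴ, by rw [conjTranspose_conjTranspose, h2], by rw [conjTranspose_conjTranspose, h1]⟩

theorem Equivalent.trans {p q r : MatrixProjection A} (h : Equivalent p q)
    (h' : Equivalent q r) : Equivalent p r := by
  obtain ⟨v, h1, h2⟩ := h
  obtain ⟨w, h3, h4⟩ := h'
  have hp : p.mat * p.mat = p.mat := p.isProj.isIdempotentElem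
  have hr : r.mat * r.mat = r.mat := r.isProj.isIdempotentElem
  refine ⟨v * w, ?_, ?_⟩
  · calc v * w * (v * w)ᴴ = v * (w * wᴴ) * vᴴ := by
          simp only [conjTranspose_mul, Matrix.mul_assoc]
      _ = (v * vᴴ) * (v * vᴴ) := by rw [h3, ← h2]; simp only [Matrix.mul_assoc]
      _ = p.mat := by rw [h1, hp]
  · calc (v * w)ᴴ * (v * w) = wᴴ * (vᴴ * v) * w := by
          simp only [conjTranspose_mul, Matrix.mul_assoc]
      _ = (wᴴ * w) * (wᴴ * w) := by rw [h2, ← h3]; simp only [Matrix.mul_assoc]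
      _ = r.mat := by rw [h4, hr]

instance setoid (A : Type*) [Ring A] [StarRing A] : Setoid (MatrixProjection A) where
  r := Equivalent
  iseqv := ⟨Equivalent.refl, Equivalent.symm, Equivalent.trans⟩

/-- A projection matrix over an arbitrary finite index type, as a projection. -/
def ofIndex {k : ℕ} {ι : Type*} [Fintype ι] (e : ι ≃ Fin k) (p : Matrix ι ι A)
    (hp : IsStarProjection p) : MatrixProjection A where
  size := k
  mat := p.submatrix e.symm e.symm
  isProj := by
    have h1 : pᴴ = p := hp.isSelfAdjoint
    have h2 : p * p = p := hp.isIdempotentElem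
    refine ⟨?_, ?_⟩
    · rw [IsIdempotentElem, Matrix.submatrix_mul_equiv, h2]
    · rw [IsSelfAdjoint, Matrix.star_eq_conjTranspose, Matrix.conjTranspose_submatrix, h1]

theorem equivalent_ofIndex {k l : ℕ} {ι κ : Type*} [Fintype ι] [Fintype κ] (e : ι ≃ Fin k)
    (f : κ ≃ Fin l) {p : Matrix ι ι A} {q : Matrix κ κ A} (hp : IsStarProjection p)
    (hq : IsStarProjection q) (v : Matrix ι κ A) (h1 : v * vᴴ = p) (h2 : vᴴ * v = q) :
    Equivalent (ofIndex e p hp) (ofIndex f q hq) := by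
  have h1' : v.submatrix e.symm f.symm * (v.submatrix e.symm f.symm)ᴴ =
      p.submatrix e.symm e.symm := by
    rw [Matrix.conjTranspose_submatrix, Matrix.submatrix_mul_equiv, h1]
  have h2' : (v.submatrix e.symm f.symm)ᴴ * v.submatrix e.symm f.symm =
      q.submatrix f.symm f.symm := by
    rw [Matrix.conjTranspose_submatrix, Matrix.submatrix_mul_equiv, h2]
  exact ⟨v.submatrix e.symm f.symm, h1', h2'⟩

theorem isStarProjection_fromBlocks {ι κ : Type*} [Fintype ι] [Fintype κ]
    {p : Matrix ι ι A} {q : Matrix κ κ A} (hp : IsStarProjection p) (hq : IsStarProjection q) :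
    IsStarProjection (Matrix.fromBlocks p 0 0 q) := by
  have h1 : pᴴ = p := hp.isSelfAdjoint
  have h2 : p * p = p := hp.isIdempotentElem
  have h3 : qᴴ = q := hq.isSelfAdjoint
  have h4 : q * q = q := hq.isIdempotentElem
  refine ⟨?_, ?_⟩
  · simp [IsIdempotentElem, Matrix.fromBlocks_multiply, h2, h4]
  · simp [IsSelfAdjoint, Matrix.star_eq_conjTranspose, Matrix.fromBlocks_conjTranspose, h1, h3]

/-- The block diagonal sum `p ⊕ q` of two projections. -/
def directSum (p q : MatrixProjection A) : MatrixProjection A :=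
  ofIndex finSumFinEquiv (Matrix.fromBlocks p.mat 0 0 q.mat)
    (isStarProjection_fromBlocks p.isProj q.isProj)

/-- The empty (`0 × 0`) projection. -/
def empty : MatrixProjection A := ⟨0, 0, ⟨by simp [IsIdempotentElem], by simp⟩⟩

/-- The unit of `A`, as a `1 × 1` matrix. -/
def unit : MatrixProjection A := ⟨1, 1, ⟨by simp [IsIdempotentElem], by simp⟩⟩

theorem equivalent_reindex {k l : ℕ} {ι κ : Type*} [Fintype ι] [Fintype κ] (e : ι ≃ Fin k)
    (f : κ ≃ Fin l) (g : κ ≃ ι) {p : Matrix ι ι A} {q : Matrix κ κ A} (hp : IsStarProjection p)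
    (hq : IsStarProjection q) (h : q = p.submatrix g g) :
    Equivalent (ofIndex e p hp) (ofIndex f q hq) := by
  have h1 : pᴴ = p := hp.isSelfAdjoint
  have h2 : p * p = p := hp.isIdempotentElem
  refine equivalent_ofIndex e f hp hq (p.submatrix id g) ?_ ?_
  · rw [Matrix.conjTranspose_submatrix, h1, Matrix.submatrix_mul_equiv, h2, Matrix.submatrix_id_id]
  · rw [Matrix.conjTranspose_submatrix, h1, h, ← Matrix.submatrix_mul p p g id g
      Function.bijective_id, h2]

theorem directSum_congr {p p' q q' : MatrixProjection A} (h : Equivalent p p')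
    (h' : Equivalent q q') : Equivalent (directSum p q) (directSum p' q') := by
  obtain ⟨v, h1, h2⟩ := h
  obtain ⟨w, h3, h4⟩ := h'
  refine equivalent_ofIndex _ _ _ _ (Matrix.fromBlocks v 0 0 w) ?_ ?_
  · simp [Matrix.fromBlocks_multiply, Matrix.fromBlocks_conjTranspose, h1, h3]
  · simp [Matrix.fromBlocks_multiply, Matrix.fromBlocks_conjTranspose, h2, h4]

theorem directSum_comm (p q : MatrixProjection A) :
    Equivalent (directSum p q) (directSum q p) := by
  refine equivalent_reindex _ _ (Equiv.sumComm _ _) _ _ ?_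
  ext (i | i) (j | j) <;> rfl

/-- The regrouping of `a + (b + c)` indices as `(a + b) + c` indices. -/
def regroup (a b c : ℕ) : Fin a ⊕ Fin (b + c) ≃ Fin (a + b) ⊕ Fin c :=
  ((Equiv.sumCongr (Equiv.refl _) finSumFinEquiv.symm).trans
    (Equiv.sumAssoc _ _ _).symm).trans (Equiv.sumCongr finSumFinEquiv (Equiv.refl _))

theorem fromBlocks_regroup {R : Type*} [Zero R] {a b c : ℕ} (p : Matrix (Fin a) (Fin a) R)
    (q : Matrix (Fin b) (Fin b) R) (r : Matrix (Fin c) (Fin c) R) :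
    Matrix.fromBlocks p 0 0
      ((Matrix.fromBlocks q 0 0 r).submatrix finSumFinEquiv.symm finSumFinEquiv.symm) =
    (Matrix.fromBlocks
      ((Matrix.fromBlocks p 0 0 q).submatrix finSumFinEquiv.symm finSumFinEquiv.symm)
      0 0 r).submatrix (regroup a b c) (regroup a b c) := by
  ext i j
  obtain ⟨i, rfl⟩ := (Equiv.sumCongr (Equiv.refl (Fin a))
    (finSumFinEquiv (m := b) (n := c))).surjective i
  obtain ⟨j, rfl⟩ := (Equiv.sumCongr (Equiv.refl (Fin a))
    (finSumFinEquiv (m := b) (n := c))).surjective j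
  rcases i with i | i | i <;> rcases j with j | j | j <;> simp [regroup]

theorem directSum_assoc (p q r : MatrixProjection A) :
    Equivalent (directSum (directSum p q) r) (directSum p (directSum q r)) :=
  equivalent_reindex _ _ (regroup p.size q.size r.size) _ _
    (fromBlocks_regroup p.mat q.mat r.mat)

theorem empty_directSum (p : MatrixProjection A) : Equivalent (directSum empty p) p := by
  refine equivalent_reindex (ι := Fin 0 ⊕ Fin p.size) finSumFinEquiv (Equiv.refl _)
    (Equiv.emptySum (Fin 0) (Fin p.size)).symm
    (isStarProjection_fromBlocks (empty (A := A)).isProj p.isProj) p.isProj ?_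
  rfl

end MatrixProjection

/-- The semigroup `V(A)` of equivalence classes of projections in matrix algebras over `A`. -/
def ProjectionClass (A : Type*) [Ring A] [StarRing A] : Type _ :=
  Quotient (MatrixProjection.setoid A)

namespace ProjectionClass

variable {A : Type*} [Ring A] [StarRing A]

/-- The class of a projection. -/
def mk (p : MatrixProjection A) : ProjectionClass A :=
  Quotient.mk (MatrixProjection.setoid A) p

/-- Addition of classes is induced by the block diagonal sum `p ⊕ q`, that is, by the sum of
orthogonal representatives. -/
instance instAdd : Add (ProjectionClass A) where
  add := Quotient.map₂ MatrixProjection.directSum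
    fun _ _ h _ _ h' => MatrixProjection.directSum_congr h h'

instance instZero : Zero (ProjectionClass A) where
  zero := mk MatrixProjection.empty

instance instAddCommMonoid : AddCommMonoid (ProjectionClass A) where
  add_assoc := by
    rintro ⟨p⟩ ⟨q⟩ ⟨r⟩
    exact Quotient.sound (MatrixProjection.directSum_assoc p q r)
  zero_add := by
    rintro ⟨p⟩
    exact Quotient.sound (MatrixProjection.empty_directSum p)
  add_zero := by
    rintro ⟨p⟩
    exact Quotient.sound
      ((MatrixProjection.directSum_comm p _).trans (MatrixProjection.empty_directSum p))
  add_comm := by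
    rintro ⟨p⟩ ⟨q⟩
    exact Quotient.sound (MatrixProjection.directSum_comm p q)
  nsmul := nsmulRec

end ProjectionClass

/-- The group `K₀(A)`: the Grothendieck group of the semigroup `V(A)`. -/
abbrev KZero (A : Type*) [Ring A] [StarRing A] : Type _ :=
  Algebra.GrothendieckAddGroup (ProjectionClass A)

namespace KZero

/-- The class `[p]` in `K₀(A)` of a projection `p`. -/
def ofProjection {A : Type*} [Ring A] [StarRing A] (p : MatrixProjection A) : KZero A :=
  Algebra.GrothendieckAddGroup.of (ProjectionClass.mk p)

/-- The positive cone `K₀⁺(A)`: the classes of projections. -/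
def positiveCone (A : Type*) [Ring A] [StarRing A] : Set (KZero A) :=
  Set.range ofProjection

/-- The order unit `[1]`. -/
def orderUnit (A : Type*) [Ring A] [StarRing A] : KZero A :=
  ofProjection MatrixProjection.unit

end KZero

/-! ### Bratteli diagrams -/

/-- A Bratteli diagram with `n` vertices on each level. The entry `(i, j)` of `mult k` is the
number of edges from the `i`-th vertex of level `k` to the `j`-th vertex of level `k + 1`, and
`dim i` is the size of the `i`-th matrix algebra on level `0`. -/
structure BratteliDiagram (n : ℕ) where
  mult : ℕ → Matrix (Fin n) (Fin n) ℕ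
  dim : Fin n → ℕ

namespace BratteliDiagram

/-- The product `P_k P_{k+1} ⋯ P_{l-1}` of the consecutive multiplicity matrices. -/
def block {n : ℕ} (B : BratteliDiagram n) (k l : ℕ) : Matrix (Fin n) (Fin n) ℕ :=
  ((List.Ico k l).map B.mult).prod

/-- The homomorphism `ℤⁿ → ℤⁿ` from level `k` to level `l`, given by the product of the
multiplicity matrices acting on row vectors. -/
def transition {n : ℕ} (B : BratteliDiagram n) (k l : ℕ) (_ : k ≤ l) :
    (Fin n → ℤ) →+ (Fin n → ℤ) :=
  (Matrix.vecMulLinear ((B.block k l).map (Nat.cast : ℕ → ℤ))).toAddMonoidHom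

/-- The dimension group of the diagram: the inductive limit of `ℤⁿ → ℤⁿ → ℤⁿ → ⋯`. -/
abbrev dimensionGroup {n : ℕ} (B : BratteliDiagram n) : Type :=
  AddCommGroup.DirectLimit (fun _ : ℕ => Fin n → ℤ) B.transition

/-- The image in the dimension group of a vector on level `k`. -/
noncomputable def ofLevel {n : ℕ} (B : BratteliDiagram n) (k : ℕ) : (Fin n → ℤ) →+ B.dimensionGroup :=
  AddCommGroup.DirectLimit.of (fun _ : ℕ => Fin n → ℤ) B.transition k

/-- The positive cone of the inductive limit of the simplicially ordered groups `ℤⁿ`. -/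
noncomputable def positiveCone {n : ℕ} (B : BratteliDiagram n) : Set B.dimensionGroup :=
  {g | ∃ (k : ℕ) (x : Fin n → ℤ), (∀ i, 0 ≤ x i) ∧ B.ofLevel k x = g}

/-- The order unit of the dimension group. -/
noncomputable def orderUnit {n : ℕ} (B : BratteliDiagram n) : B.dimensionGroup :=
  B.ofLevel 0 fun i => (B.dim i : ℤ)

/-- The sequence of multiplicity matrices can be divided into consecutive non-empty blocks
`{P_{s k}, …, P_{s (k+1) - 1}}` whose products are all equal to one strictly positive matrix. -/
def IsStationary {n : ℕ} (B : BratteliDiagram n) : Prop :=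
  ∃ P : Matrix (Fin n) (Fin n) ℕ, (∀ i j, 0 < P i j) ∧
    ∃ s : ℕ → ℕ, s 0 = 0 ∧ StrictMono s ∧ ∀ k, B.block (s k) (s (k + 1)) = P

end BratteliDiagram

namespace IntervalExchange

/-- `B` is a Bratteli diagram of `T`: the dimension group of `B` is isomorphic, as an ordered
group with order unit, to `(K₀, K₀⁺, [1])` of the C*-algebra of `T`. -/
def HasBratteliDiagram {n : ℕ} (T : IntervalExchange n) (B : BratteliDiagram n) : Prop :=
  ∃ e : KZero T.cstarAlgebra ≃+ B.dimensionGroup,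
    e '' KZero.positiveCone T.cstarAlgebra = B.positiveCone ∧
      e (KZero.orderUnit T.cstarAlgebra) = B.orderUnit

/-- `T` is stationary if it has a stationary Bratteli diagram. -/
def IsStationary {n : ℕ} (T : IntervalExchange n) : Prop :=
  ∃ B : BratteliDiagram n, T.HasBratteliDiagram B ∧ B.IsStationary

end IntervalExchange

/-!
An invariant measure `μ` yields a tracial state on the C*-algebra: average, against `μ`, the matrix
coefficients `⟪ξ x, a (ξ x)⟫` at normalized indicator functions `ξ x` of short intervals at `x`
(on both sides of `x` if there are flips, to the right of `x` otherwise), and pass to the limit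
along an ultrafilter. This state takes the value `μ s` at the indicator of every set `s` that is
coded by finitely many coordinates of the itinerary. Tracial states induce states of the dimension
group `K₀`, and a stationary dimension group has only one state: as the matrix is strictly
positive, every nonzero positive functional dominates a positive multiple of every other one, and
subtracting the largest such multiple leaves zero. So `μ` agrees with Lebesgue measure on the coded
sets.

The coded sets determine the measure as soon as distinct points have distinct itineraries. The
points between two points with the same itinerary share this itinerary, so it would otherwise be an
atom of a shift-invariant measure, hence periodic, and the indicators of the sets of points with
the itineraries in its orbit would span a finite-dimensional representation of the C*-algebra.
Ranks of projections in this representation would give a nonzero homomorphism from the dimension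
group with values in `ℕ` on the positive cone. But for `n ≥ 2` the sum of its values on the unit
vectors is at least halved from each level to the next, so that they vanish.
-/

section BackwardOrbit

open Matrix

variable {ι R : Type*} [Fintype ι]

/-- A sequence of vectors with `x k = A k *ᵥ x (k + 1)`. The values which a homomorphism takes on
the unit vectors of the levels of an inductive limit along matrices acting on row vectors form
such a sequence. -/
def IsBackwardOrbit [NonUnitalNonAssocSemiring R] (A : ℕ → Matrix ι ι R) (x : ℕ → ι → R) : Prop :=
  ∀ k, x k = A k *ᵥ x (k + 1)

namespace IsBackwardOrbit

theorem sub [NonUnitalNonAssocRing R] {A : ℕ → Matrix ι ι R} {x y : ℕ → ι → R}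
    (hx : IsBackwardOrbit A x) (hy : IsBackwardOrbit A y) : IsBackwardOrbit A (x - y) := fun k => by
  simp only [Pi.sub_apply, mulVec_sub, ← hx k, ← hy k]

theorem const_smul [CommSemiring R] {A : ℕ → Matrix ι ι R} {x : ℕ → ι → R}
    (hx : IsBackwardOrbit A x) (t : R) : IsBackwardOrbit A (t • x) := fun k => by
  simp only [Pi.smul_apply, mulVec_smul, ← hx k]

section Real

variable {A : ℕ → Matrix ι ι ℝ} {x y : ℕ → ι → ℝ} {K : ℝ}

theorem le_of_apply_le (hA : ∀ k i j, 0 ≤ A k i j) (hx : IsBackwardOrbit A x)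
    (hy : IsBackwardOrbit A y) {k l : ℕ} (hkl : k ≤ l) (h : x l ≤ y l) : x k ≤ y k := by
  induction hkl using Nat.decreasingInduction with
  | self => exact h
  | of_succ m _ ih =>
    intro i
    rw [hx m, hy m]
    exact dotProduct_le_dotProduct_of_nonneg_left ih (hA m i)

theorem le_mul (hK : ∀ k i i' j, A k i j ≤ K * A k i' j) (hx : IsBackwardOrbit A x) (hx0 : 0 ≤ x)
    (k : ℕ) (i i' : ι) : x k i ≤ K * x k i' := by
  simp only [hx k, mulVec, dotProduct, Finset.mul_sum, ← mul_assoc]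
  exact Finset.sum_le_sum fun j _ => mul_le_mul_of_nonneg_right (hK k i i' j) (hx0 (k + 1) j)

theorem exists_smul_le (hA : ∀ k i j, 0 ≤ A k i j) (hK : ∀ k i i' j, A k i j ≤ K * A k i' j)
    (hx : IsBackwardOrbit A x) (hx0 : 0 ≤ x) (hy : IsBackwardOrbit A y) (hy0 : 0 < y) :
    ∃ δ : ℝ, 0 < δ ∧ δ • x ≤ y := by
  obtain ⟨hy0, k₀, hk₀⟩ := Pi.lt_def.1 hy0
  obtain ⟨-, i₀, hpos⟩ := Pi.lt_def.1 hk₀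
  have hK0 : 0 < K := pos_of_mul_pos_left (hpos.trans_le (hy.le_mul hK hy0 k₀ i₀ i₀)) hpos.le
  obtain ⟨ε, hε, hlt⟩ : ∃ ε : ℝ, 0 < ε ∧ ε * x k₀ i₀ < y k₀ i₀ := by
    have hxpos : 0 < x k₀ i₀ + 1 := add_pos_of_nonneg_of_pos (hx0 k₀ i₀) one_pos
    have hypos : 0 < y k₀ i₀ := hpos
    refine ⟨y k₀ i₀ / (x k₀ i₀ + 1), by positivity, ?_⟩
    rw [div_mul_eq_mul_div, div_lt_iff₀ hxpos]
    linarith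
  have hcoord (k : ℕ) (hk : k₀ ≤ k) : ∃ l, ε * x k l ≤ y k l := by
    by_contra! h
    exact hlt.not_ge (le_of_apply_le hA hy (hx.const_smul ε) hk (fun l => (h l).le) i₀)
  have hlate (k : ℕ) (hk : k₀ ≤ k) : ((ε / K ^ 2) • x) k ≤ y k := fun i => by
    obtain ⟨l, hl⟩ := hcoord k hk
    have h1 : ε * x k i ≤ K ^ 2 * y k i :=
      calc ε * x k i ≤ ε * (K * x k l) := by gcongr; exact hx.le_mul hK hx0 k i l
        _ = K * (ε * x k l) := by ring
        _ ≤ K * (K * y k i) :=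
          mul_le_mul_of_nonneg_left (hl.trans (hy.le_mul hK hy0 k l i)) hK0.le
        _ = K ^ 2 * y k i := by ring
    simp only [Pi.smul_apply, smul_eq_mul]
    rw [div_mul_eq_mul_div, div_le_iff₀ (by positivity)]
    linarith
  refine ⟨ε / K ^ 2, by positivity, fun k => ?_⟩
  exact le_of_apply_le hA (hx.const_smul _) hy (le_max_left k k₀) (hlate _ (le_max_right k k₀))

theorem exists_eq_smul (hA : ∀ k i j, 0 ≤ A k i j) (hK : ∀ k i i' j, A k i j ≤ K * A k i' j)
    (hx : IsBackwardOrbit A x) (hx0 : 0 ≤ x) (hy : IsBackwardOrbit A y) (hy0 : 0 < y) :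
    ∃ t : ℝ, x = t • y := by
  let S : Set ℝ := {t | t • y ≤ x}
  have hclosed : IsClosed S :=
    isClosed_le (continuous_id.smul continuous_const) continuous_const
  have hbdd : BddAbove S := by
    obtain ⟨-, k, hk⟩ := Pi.lt_def.1 hy0
    obtain ⟨-, i, hki⟩ := Pi.lt_def.1 hk
    exact ⟨x k i / y k i, fun t ht => (le_div_iff₀ hki).2 (ht k i)⟩
  have hmem : sSup S ∈ S := hclosed.csSup_mem ⟨0, by simpa [S] using hx0⟩ hbdd
  refine ⟨sSup S, ?_⟩
  by_contra hne
  obtain ⟨δ, hδ, hle⟩ := exists_smul_le hA hK hy hy0.le (hx.sub (hy.const_smul (sSup S)))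
    (sub_pos.2 (lt_of_le_of_ne hmem (Ne.symm hne)))
  have hmem_add : sSup S + δ ∈ S := by
    change (sSup S + δ) • y ≤ x
    rw [add_smul, add_comm]
    exact le_sub_iff_add_le.1 hle
  linarith [le_csSup hbdd hmem_add]

end Real

theorem eq_zero_of_nat [Nontrivial ι] {A : ℕ → Matrix ι ι ℕ} {x : ℕ → ι → ℕ}
    (hA : ∀ k i j, 0 < A k i j) (hx : IsBackwardOrbit A x) : x = 0 := by
  have hle (k : ℕ) (i : ι) : ∑ j, x (k + 1) j ≤ x k i := by
    rw [hx k]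
    exact Finset.sum_le_sum fun j _ => Nat.le_mul_of_pos_left _ (hA k i j)
  have hdouble (k : ℕ) : 2 * ∑ j, x (k + 1) j ≤ ∑ i, x k i :=
    calc 2 * ∑ j, x (k + 1) j ≤ Fintype.card ι * ∑ j, x (k + 1) j := by
          gcongr
          exact Fintype.one_lt_card
      _ = ∑ _i : ι, ∑ j, x (k + 1) j := by simp
      _ ≤ ∑ i, x k i := Finset.sum_le_sum fun i _ => hle k i
  have hzero (N : ℕ) : ∀ k, ∑ i, x k i = N → x k = 0 := by
    induction N using Nat.strong_induction_on with
    | h N ih =>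
      rintro k rfl
      by_contra hk
      have hpos : 0 < ∑ i, x k i := Fintype.sum_pos (pos_iff_ne_zero.2 hk)
      have hnext : x (k + 1) = 0 := ih _ (by have := hdouble k; omega) (k + 1) rfl
      exact hk (by rw [hx k, hnext, mulVec_zero])
  exact funext fun k => hzero _ k rfl

end IsBackwardOrbit

end BackwardOrbit

section DimensionGroup

/-- A state of an abelian group `G` with positive cone `C` and order unit `u`: a homomorphism to
`ℝ` which is nonnegative on `C` and normalized at `u`. -/
structure IsState {G : Type*} [AddCommGroup G] (C : Set G) (u : G) (s : G →+ ℝ) : Prop where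
  nonneg : ∀ g ∈ C, 0 ≤ s g
  map_unit : s u = 1

theorem IsState.comp_symm {G H : Type*} [AddCommGroup G] [AddCommGroup H] {C : Set G} {u : G}
    {s : G →+ ℝ} (hs : IsState C u s) (e : G ≃+ H) :
    IsState (e '' C) (e u) (s.comp e.symm.toAddMonoidHom) where
  nonneg := by
    rintro _ ⟨g, hg, rfl⟩
    simpa using hs.nonneg g hg
  map_unit := by simpa using hs.map_unit

namespace BratteliDiagram

open Matrix

variable {n : ℕ} {B : BratteliDiagram n}

theorem ofLevel_transition {k l : ℕ} (h : k ≤ l) (x : Fin n → ℤ) :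
    B.ofLevel l (B.transition k l h x) = B.ofLevel k x :=
  AddCommGroup.DirectLimit.of_f (G := fun _ : ℕ => Fin n → ℤ) (f := B.transition) h x

theorem ofLevel_single_mem_positiveCone (k : ℕ) (i : Fin n) :
    B.ofLevel k (Pi.single i 1) ∈ B.positiveCone :=
  ⟨k, _, fun j => (Pi.single_nonneg.2 zero_le_one : (0 : Fin n → ℤ) ≤ Pi.single i 1) j, rfl⟩

variable {R : Type*} [Ring R]

/-- The values of a homomorphism on the unit vectors of level `k`. -/
noncomputable def levelValues (s : B.dimensionGroup →+ R) (k : ℕ) (i : Fin n) : R :=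
  s (B.ofLevel k (Pi.single i 1))

theorem map_ofLevel (s : B.dimensionGroup →+ R) (k : ℕ) (x : Fin n → ℤ) :
    s (B.ofLevel k x) = ∑ i, x i * levelValues s k i := by
  have hx : x = ∑ i, x i • Pi.single i (1 : ℤ) := by
    ext j
    simp [Finset.sum_apply, Pi.single_apply]
  conv_lhs => rw [hx]
  simp only [map_sum, map_zsmul, levelValues, ← zsmul_eq_mul]

theorem levelValues_eq_mulVec (s : B.dimensionGroup →+ R) {k l : ℕ} (h : k ≤ l) :
    levelValues s k = (B.block k l).map (Nat.cast : ℕ → R) *ᵥ levelValues s l := by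
  ext i
  rw [levelValues, ← ofLevel_transition h, map_ofLevel]
  simp [transition, mulVec, dotProduct]

theorem isBackwardOrbit_levelValues (s : B.dimensionGroup →+ R) {σ : ℕ → ℕ} (hσ : Monotone σ) :
    IsBackwardOrbit (fun k => (B.block (σ k) (σ (k + 1))).map (Nat.cast : ℕ → R))
      (fun k => levelValues s (σ k)) :=
  fun k => levelValues_eq_mulVec s (hσ k.le_succ)

theorem hom_ext_of_levelValues {s t : B.dimensionGroup →+ R} {σ : ℕ → ℕ} (hσ : ∀ k, k ≤ σ k)
    (h : ∀ k, levelValues s (σ k) = levelValues t (σ k)) : s = t := by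
  refine AddMonoidHom.ext fun g => ?_
  induction g using AddCommGroup.DirectLimit.induction_on with
  | ih k x =>
    change s (B.ofLevel k x) = t (B.ofLevel k x)
    rw [← ofLevel_transition (hσ k), map_ofLevel, map_ofLevel, h]

theorem IsStationary.state_unique (hB : B.IsStationary) {s t : B.dimensionGroup →+ ℝ}
    (hs : IsState B.positiveCone B.orderUnit s) (ht : IsState B.positiveCone B.orderUnit t) :
    s = t := by
  obtain ⟨P, hP, σ, -, hσ, hPσ⟩ := hB
  have horbit (r : B.dimensionGroup →+ ℝ) : IsBackwardOrbit (fun _ => P.map (Nat.cast : ℕ → ℝ))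
      (fun k => levelValues r (σ k)) := by
    simpa only [hPσ] using isBackwardOrbit_levelValues r hσ.monotone
  have hnonneg {r : B.dimensionGroup →+ ℝ} (hr : IsState B.positiveCone B.orderUnit r) :
      0 ≤ fun k => levelValues r (σ k) :=
    fun k i => hr.nonneg _ (ofLevel_single_mem_positiveCone _ i)
  have hpos : 0 < fun k => levelValues t (σ k) := by
    refine lt_of_le_of_ne (hnonneg ht) fun h0 => one_ne_zero (α := ℝ) ?_
    have ht0 : t = 0 := hom_ext_of_levelValues (fun k => hσ.le_apply) fun k => (congrFun h0 k).symm
    rw [← ht.map_unit, ht0, AddMonoidHom.zero_apply]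
  have hratio (i i' j : Fin n) : (P i j : ℝ) ≤ (∑ a, ∑ b, P a b : ℕ) * (P i' j : ℝ) := by
    have h1 : P i j ≤ ∑ a, ∑ b, P a b :=
      (Finset.single_le_sum_of_canonicallyOrdered (Finset.mem_univ j)).trans
        (Finset.single_le_sum_of_canonicallyOrdered (f := fun a => ∑ b, P a b) (Finset.mem_univ i))
    exact_mod_cast h1.trans (Nat.le_mul_of_pos_right _ (hP i' j))
  obtain ⟨c, hc⟩ := IsBackwardOrbit.exists_eq_smul (fun _ i j => Nat.cast_nonneg (P i j))
    (fun _ => hratio) (horbit s) (hnonneg hs) (horbit t) hpos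
  have hsc : s = c • t := hom_ext_of_levelValues (fun k => hσ.le_apply) fun k => congrFun hc k
  have hc1 : c = 1 := by
    simpa [hsc, ht.map_unit] using hs.map_unit
  rw [hsc, hc1, one_smul]

theorem IsStationary.eq_zero_of_nat_valued [CharZero R] (hn : 2 ≤ n) (hB : B.IsStationary)
    {s : B.dimensionGroup →+ R} (hs : ∀ g ∈ B.positiveCone, s g ∈ Set.range (Nat.cast : ℕ → R)) :
    s = 0 := by
  have : Nontrivial (Fin n) := Fin.nontrivial_iff_two_le.2 hn
  obtain ⟨P, hP, σ, -, hσ, hPσ⟩ := hB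
  choose x hx using fun k i => hs _ (ofLevel_single_mem_positiveCone (σ k) i)
  have hcast (k : ℕ) : levelValues s (σ k) = fun i => (x k i : R) := funext fun i => (hx k i).symm
  have horbit : IsBackwardOrbit (fun _ => P) x := fun k => by
    ext i
    have h := congrFun (levelValues_eq_mulVec s (hσ.monotone k.le_succ)) i
    rw [hPσ, hcast, hcast] at h
    refine Nat.cast_injective (R := R) ?_
    simpa [mulVec, dotProduct] using h
  have hx0 : x = 0 := horbit.eq_zero_of_nat fun _ => hP
  refine hom_ext_of_levelValues (fun k => hσ.le_apply) fun k => ?_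
  rw [hcast, hx0]
  ext i
  simp [levelValues]

end BratteliDiagram

end DimensionGroup

section Trace

variable {A R : Type*} [Ring A] [StarRing A] [AddCommGroup R]

/-- Traces, without any positivity or normalization. -/
def IsTracial {A R : Type*} [Mul A] [AddZeroClass A] [AddZeroClass R] (τ : A →+ R) : Prop :=
  ∀ a b, τ (a * b) = τ (b * a)

/-- Tracial states: positive traces of total mass one. -/
structure IsTracialState (τ : A →+ ℝ) : Prop where
  isTracial : IsTracial τ
  nonneg : ∀ a, 0 ≤ τ (star a * a)
  map_one : τ 1 = 1

/-- The additive map on classes of projections induced by a trace. -/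
def ProjectionClass.ofTrace (τ : A →+ R) (hτ : IsTracial τ) : ProjectionClass A →+ R where
  toFun := Quotient.lift (fun p : MatrixProjection A => ∑ i, τ (p.mat i i)) (by
    rintro p q ⟨v, hp, hq⟩
    simp only [← hp, ← hq, Matrix.mul_apply, map_sum]
    rw [Finset.sum_comm]
    exact Finset.sum_congr rfl fun i _ => Finset.sum_congr rfl fun j _ => hτ _ _)
  map_zero' := Fin.sum_univ_zero _
  map_add' := by
    rintro ⟨p⟩ ⟨q⟩
    change ∑ i : Fin (p.size + q.size), τ ((Matrix.fromBlocks p.mat 0 0 q.mat).submatrix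
      finSumFinEquiv.symm finSumFinEquiv.symm i i) =
        ∑ i, τ (p.mat i i) + ∑ i, τ (q.mat i i)
    rw [← finSumFinEquiv.sum_comp, Fintype.sum_sum_type]
    simp

/-- A projection of `A`, as a `1 × 1` matrix. -/
def MatrixProjection.single (p : A) (hp : IsStarProjection p) : MatrixProjection A where
  size := 1
  mat := Matrix.of fun _ _ => p
  isProj := by
    refine ⟨?_, ?_⟩
    · ext i j
      simpa [Matrix.mul_apply] using hp.isIdempotentElem.eq
    · ext i j
      simpa [Matrix.star_apply] using hp.isSelfAdjoint.star_eq

namespace KZero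

/-- The homomorphism on `K₀` induced by a trace. -/
noncomputable def ofTrace (τ : A →+ R) (hτ : IsTracial τ) : KZero A →+ R :=
  Algebra.GrothendieckAddGroup.lift (ProjectionClass.ofTrace τ hτ)

theorem ofTrace_ofProjection (τ : A →+ R) (hτ : IsTracial τ) (p : MatrixProjection A) :
    ofTrace τ hτ (ofProjection p) = ∑ i, τ (p.mat i i) :=
  DFunLike.congr_fun (Algebra.GrothendieckAddGroup.lift.symm_apply_apply
    (ProjectionClass.ofTrace τ hτ)) (ProjectionClass.mk p)

theorem ofTrace_single (τ : A →+ R) (hτ : IsTracial τ) {p : A} (hp : IsStarProjection p) :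
    ofTrace τ hτ (ofProjection (MatrixProjection.single p hp)) = τ p :=
  (ofTrace_ofProjection τ hτ _).trans (Fin.sum_univ_one _)

theorem ofTrace_orderUnit (τ : A →+ R) (hτ : IsTracial τ) : ofTrace τ hτ (orderUnit A) = τ 1 :=
  (ofTrace_ofProjection τ hτ _).trans (Fin.sum_univ_one _)

end KZero

theorem IsTracialState.isState_ofTrace {τ : A →+ ℝ} (hτ : IsTracialState τ) :
    IsState (KZero.positiveCone A) (KZero.orderUnit A) (KZero.ofTrace τ hτ.isTracial) where
  nonneg := by
    rintro _ ⟨p, rfl⟩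
    have hp : p.mat = star p.mat * p.mat := by
      rw [p.isProj.isSelfAdjoint.star_eq, p.isProj.isIdempotentElem.eq]
    rw [KZero.ofTrace_ofProjection]
    refine Finset.sum_nonneg fun i _ => ?_
    rw [hp, Matrix.mul_apply, map_sum]
    exact Finset.sum_nonneg fun j _ => hτ.nonneg _
  map_unit := (KZero.ofTrace_orderUnit τ _).trans hτ.map_one

end Trace

section Representation

variable {A k W : Type*} [Ring A] [Field k] [AddCommGroup W] [Module k W]

/-- The trace of a representation; it is meaningful for finite-dimensional representations, and
zero otherwise. -/
noncomputable def representationTrace (ρ : A →+* Module.End k W) : A →+ k :=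
  (LinearMap.trace k W).toAddMonoidHom.comp ρ.toAddMonoidHom

theorem representationTrace_apply (ρ : A →+* Module.End k W) (a : A) :
    representationTrace ρ a = LinearMap.trace k W (ρ a) :=
  rfl

theorem isTracial_representationTrace (ρ : A →+* Module.End k W) :
    IsTracial (representationTrace ρ) := fun a b => by
  simp only [representationTrace_apply, map_mul, LinearMap.trace_mul_comm]

variable [FiniteDimensional k W]

/- A representation on `W` maps an `m × m` projection to an idempotent of `Wᵐ`, whose trace is its
rank. -/
theorem KZero.ofTrace_representationTrace_mem_range_natCast [StarRing A] (ρ : A →+* Module.End k W)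
    {g : KZero A} (hg : g ∈ positiveCone A) :
    ofTrace _ (isTracial_representationTrace ρ) g ∈ Set.range (Nat.cast : ℕ → k) := by
  obtain ⟨p, rfl⟩ := hg
  let b := Module.finBasis k W
  let ρ' : A →+* Matrix (Fin (Module.finrank k W)) (Fin (Module.finrank k W)) k :=
    (LinearMap.toMatrixAlgEquiv b : _ →ₐ[k] _).toRingHom.comp ρ
  let M := Matrix.compRingEquiv (Fin p.size) (Fin (Module.finrank k W)) k (p.mat.map ρ')
  have hM : IsIdempotentElem (Matrix.toLin' M) := by
    rw [IsIdempotentElem, Module.End.mul_eq_comp, ← Matrix.toLin'_mul, ← map_mul, ← Matrix.map_mul,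
      p.isProj.isIdempotentElem.eq]
  have htrace : ∑ i, representationTrace ρ (p.mat i i) = M.trace := by
    simp only [representationTrace_apply, LinearMap.trace_eq_matrix_trace k b, Matrix.trace,
      Fintype.sum_prod_type]
    rfl
  rw [ofTrace_ofProjection, htrace, ← Matrix.trace_toLin'_eq]
  exact ⟨_, (LinearMap.IsIdempotentElem.isProj_range _ hM).trace.symm⟩

end Representation

namespace IntervalExchange

variable {n : ℕ} {T : IntervalExchange n}

theorem IsStationary.apply_eq_of_isTracialState (hT : T.IsStationary) {τ υ : T.cstarAlgebra →+ ℝ}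
    (hτ : IsTracialState τ) (hυ : IsTracialState υ) {p : T.cstarAlgebra}
    (hp : IsStarProjection p) : τ p = υ p := by
  obtain ⟨B, ⟨e, he, he1⟩, hB⟩ := hT
  have hunique := hB.state_unique (he ▸ he1 ▸ hτ.isState_ofTrace.comp_symm e)
    (he ▸ he1 ▸ hυ.isState_ofTrace.comp_symm e)
  have h := DFunLike.congr_fun hunique (e (KZero.ofProjection (MatrixProjection.single p hp)))
  simpa [KZero.ofTrace_single] using h

theorem IsStationary.subsingleton_of_representation (hn : 2 ≤ n) (hT : T.IsStationary)
    {W : Type*} [AddCommGroup W] [Module ℂ W] [FiniteDimensional ℂ W]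
    (ρ : T.cstarAlgebra →+* Module.End ℂ W) : Subsingleton W := by
  obtain ⟨B, ⟨e, he, he1⟩, hB⟩ := hT
  let s := KZero.ofTrace _ (isTracial_representationTrace ρ)
  have hs : s.comp e.symm.toAddMonoidHom = 0 := by
    refine hB.eq_zero_of_nat_valued hn fun g hg => ?_
    obtain ⟨x, hx, rfl⟩ := he.symm ▸ hg
    simpa [s] using KZero.ofTrace_representationTrace_mem_range_natCast ρ hx
  have hunit : s (KZero.orderUnit T.cstarAlgebra) = 0 := by
    simpa [← he1] using DFunLike.congr_fun hs B.orderUnit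
  rw [KZero.ofTrace_orderUnit, representationTrace_apply, map_one, LinearMap.trace_one] at hunit
  exact Module.finrank_zero_iff.1 (Nat.cast_eq_zero.1 hunit)

end IntervalExchange

section Indicator

variable {α : Type*} [MeasurableSpace α] {ν : Measure α} [IsFiniteMeasure ν] {s t : Set α}

variable (ν) in
/-- The operator on `L²(ν)` of multiplication by the characteristic function of a measurable set. -/
noncomputable def indicatorOp (hs : MeasurableSet s) : Lp ℂ 2 ν →L[ℂ] Lp ℂ 2 ν :=
  (ContinuousLinearMap.mul ℂ ℂ).holderL ν ⊤ 2 2 (indicatorConstLp ⊤ hs (measure_ne_top _ _) 1)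

variable (ν) in
/-- The characteristic function of a measurable set, as a vector of `L²(ν)`. -/
noncomputable def indicatorVec (hs : MeasurableSet s) : Lp ℂ 2 ν :=
  indicatorConstLp 2 hs (measure_ne_top _ _) 1

theorem indicatorOp_apply_ae (hs : MeasurableSet s) (ζ : Lp ℂ 2 ν) :
    indicatorOp ν hs ζ =ᵐ[ν] s.indicator ζ := by
  refine (ContinuousLinearMap.coeFn_holder (r := 2) (ContinuousLinearMap.mul ℂ ℂ) _ ζ).trans ?_
  filter_upwards [indicatorConstLp_coeFn (p := ⊤) (μ := ν) (c := (1 : ℂ)) (hs := hs)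
    (hμs := measure_ne_top _ _)] with x hx
  rw [hx]
  by_cases h : x ∈ s <;> simp [h]

theorem indicatorOp_mul (hs : MeasurableSet s) (ht : MeasurableSet t) :
    indicatorOp ν hs * indicatorOp ν ht = indicatorOp ν (hs.inter ht) := by
  refine ContinuousLinearMap.ext fun ζ => Lp.ext ?_
  filter_upwards [indicatorOp_apply_ae hs (indicatorOp ν ht ζ), indicatorOp_apply_ae ht ζ,
    indicatorOp_apply_ae (hs.inter ht) ζ] with x h1 h2 h3
  rw [mul_apply_eq_comp, h1, h3]
  by_cases h : x ∈ s <;> by_cases h' : x ∈ t <;> simp [h, h', h2]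

theorem indicatorOp_compl (hs : MeasurableSet s) :
    indicatorOp ν hs.compl = 1 - indicatorOp ν hs := by
  refine ContinuousLinearMap.ext fun ζ => Lp.ext ?_
  filter_upwards [indicatorOp_apply_ae hs ζ, indicatorOp_apply_ae hs.compl ζ,
    Lp.coeFn_sub ζ (indicatorOp ν hs ζ)] with x h1 h2 h3
  rw [sub_apply, one_apply_eq_self, h3, Pi.sub_apply, h1, h2]
  by_cases h : x ∈ s <;> simp [h]

theorem isSelfAdjoint_indicatorOp (hs : MeasurableSet s) : IsSelfAdjoint (indicatorOp ν hs) := by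
  rw [ContinuousLinearMap.isSelfAdjoint_iff_isSymmetric]
  intro ζ ξ
  simp only [ContinuousLinearMap.coe_coe, L2.inner_def]
  refine integral_congr_ae ?_
  filter_upwards [indicatorOp_apply_ae hs ζ, indicatorOp_apply_ae hs ξ] with x h1 h2
  rw [h1, h2]
  by_cases h : x ∈ s <;> simp [h]

theorem isStarProjection_indicatorOp (hs : MeasurableSet s) :
    IsStarProjection (indicatorOp ν hs) where
  isIdempotentElem := by
    rw [IsIdempotentElem, indicatorOp_mul]
    simp only [Set.inter_self]
  isSelfAdjoint := isSelfAdjoint_indicatorOp hs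

theorem indicatorVec_congr_ae {hs : MeasurableSet s} {ht : MeasurableSet t} (h : s =ᵐ[ν] t) :
    indicatorVec ν hs = indicatorVec ν ht :=
  (indicatorConstLp_inj hs _ ht _ one_ne_zero).2 h

theorem indicatorVec_eq_zero {hs : MeasurableSet s} : indicatorVec ν hs = 0 ↔ ν s = 0 := by
  rw [show (0 : Lp ℂ 2 ν) = indicatorVec ν MeasurableSet.empty from indicatorConstLp_empty.symm]
  exact (indicatorConstLp_inj hs _ MeasurableSet.empty _ one_ne_zero).trans ae_eq_empty

theorem indicatorOp_indicatorVec (hs : MeasurableSet s) (ht : MeasurableSet t) :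
    indicatorOp ν hs (indicatorVec ν ht) = indicatorVec ν (hs.inter ht) := by
  refine Lp.ext ((indicatorOp_apply_ae hs _).trans ?_)
  filter_upwards [indicatorConstLp_coeFn (p := 2) (μ := ν) (c := (1 : ℂ)) (hs := ht)
    (hμs := measure_ne_top _ _), indicatorConstLp_coeFn (p := 2) (μ := ν) (c := (1 : ℂ))
    (hs := hs.inter ht) (hμs := measure_ne_top _ _)] with x h1 h2
  change s.indicator (⇑(indicatorConstLp 2 ht _ 1)) x = (indicatorConstLp 2 (hs.inter ht) _ 1) x
  rw [h2]
  by_cases h : x ∈ s <;> by_cases h' : x ∈ t <;> simp [h, h', h1]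

theorem norm_indicatorVec_sq (hs : MeasurableSet s) : ‖indicatorVec ν hs‖ ^ 2 = ν.real s := by
  rw [indicatorVec, norm_indicatorConstLp two_ne_zero ENNReal.ofNat_ne_top, norm_one, one_mul,
    ENNReal.toReal_ofNat, ← Real.sqrt_eq_rpow, Real.sq_sqrt measureReal_nonneg]

end Indicator

namespace IntervalExchange

variable {n : ℕ} (T : IntervalExchange n)

section Intervals

theorem measurableSet_interval (i : Fin n) : MeasurableSet (T.interval i) :=
  measurableSet_Ico

theorem iUnion_interval : (⋃ i, T.interval i) = Set.Ico 0 1 := by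
  rw [← T.sum_len]
  exact (start_tiling T.len T.len_pos).1

theorem interval_subset_Ico (i : Fin n) : T.interval i ⊆ Set.Ico 0 1 :=
  (Set.subset_iUnion _ i).trans T.iUnion_interval.subset

theorem exists_mem_interval {x : ℝ} (hx : x ∈ Set.Ico (0 : ℝ) 1) : ∃ i, x ∈ T.interval i :=
  Set.mem_iUnion.1 (T.iUnion_interval.superset hx)

theorem disjoint_interval {i j : Fin n} (h : i ≠ j) : Disjoint (T.interval i) (T.interval j) :=
  (start_tiling T.len T.len_pos).2 h

theorem ae_mem_interior {μ : Measure ℝ} (hμ : μ (Set.Ico 0 1)ᶜ = 0)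
    (hleft : ∀ i, μ {T.left i} = 0) :
    ∀ᵐ x ∂μ, ∃ i, x ∈ Set.Ioo (T.left i) (T.left i + T.len i) := by
  have hne : ∀ᵐ x ∂μ, ∀ i, x ≠ T.left i := ae_all_iff.2 fun i => by simpa [ae_iff] using hleft i
  filter_upwards [mem_ae_iff.2 hμ, hne] with x hx hxne
  obtain ⟨i, hi⟩ := T.exists_mem_interval hx
  exact ⟨i, lt_of_le_of_ne hi.1 (hxne i).symm, hi.2⟩

instance : IsProbabilityMeasure lebesgue := ⟨by simp [lebesgue]⟩

theorem isInvariant_lebesgue : T.IsInvariant lebesgue where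
  carrier := by simp [lebesgue, Measure.restrict_apply measurableSet_Ico.compl]
  preserving := T.measurePreserving
  endpoints _ i := by
    simp only [lebesgue, measure_singleton]

end Intervals

section Inverse

/-- The interval exchange transformation which is inverse to `T` off the endpoints. -/
def inverse : IntervalExchange n where
  len k := T.len (T.perm.symm k)
  len_pos _ := T.len_pos _
  sum_len := (Equiv.sum_comp T.perm.symm T.len).trans T.sum_len
  perm := T.perm.symm
  sign k := T.sign (T.perm.symm k)

theorem inverse_toFun_toFun {i : Fin n} {x : ℝ}
    (hx : x ∈ Set.Ioo (T.left i) (T.left i + T.len i)) : T.inverse.toFun (T.toFun x) = x := by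
  have hlen : T.inverse.len (T.perm i) = T.len i := by simp [inverse]
  have hsign : T.inverse.sign (T.perm i) = T.sign i := by simp [inverse]
  have hleft : T.inverse.left (T.perm i) = T.imageLeft i := rfl
  have himage : T.inverse.imageLeft (T.perm i) = T.left i := by simp [inverse, imageLeft, left]
  rw [T.toFun_eq i ⟨hx.1.le, hx.2⟩, T.inverse.toFun_eq (T.perm i)]
  · simp only [piece, hsign, hleft, himage, hlen]
    split_ifs <;> ring
  · rw [interval, hleft, hlen, piece]
    split_ifs <;> constructor <;> linarith [hx.1, hx.2]

end Inverse

section Koopman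

theorem koopman_apply_ae (ζ : Hilbert) : T.koopman ζ =ᵐ[lebesgue] ζ ∘ T.toFun :=
  Lp.coeFn_compMeasurePreserving ζ T.measurePreserving

theorem koopman_indicatorVec {s : Set ℝ} (hs : MeasurableSet s) :
    T.koopman (indicatorVec lebesgue hs) = indicatorVec lebesgue (T.measurable_toFun hs) :=
  Lp.indicatorConstLp_compMeasurePreserving hs _ 1 T.measurePreserving

theorem koopman_mul_indicatorOp {s : Set ℝ} (hs : MeasurableSet s) :
    T.koopman * indicatorOp lebesgue hs =
      indicatorOp lebesgue (T.measurable_toFun hs) * T.koopman := by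
  refine ContinuousLinearMap.ext fun ζ => Lp.ext ?_
  filter_upwards [T.koopman_apply_ae (indicatorOp lebesgue hs ζ), T.koopman_apply_ae ζ,
    T.measurePreserving.quasiMeasurePreserving.ae (indicatorOp_apply_ae hs ζ),
    indicatorOp_apply_ae (T.measurable_toFun hs) (T.koopman ζ)] with x h1 h2 h3 h4
  rw [mul_apply_eq_comp, mul_apply_eq_comp, h1, h4, Function.comp_apply, h3]
  by_cases h : T.toFun x ∈ s <;> simp [h, h2]

theorem star_koopman_mul_koopman : star T.koopman * T.koopman = 1 :=
  ContinuousLinearMap.ext T.unitaryOp_comp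

theorem koopman_mul_koopman_inverse : T.koopman * T.inverse.koopman = 1 := by
  refine ContinuousLinearMap.ext fun ζ => Lp.ext ?_
  filter_upwards [T.koopman_apply_ae (T.inverse.koopman ζ),
    T.measurePreserving.quasiMeasurePreserving.ae (T.inverse.koopman_apply_ae ζ),
    T.ae_mem_interior T.isInvariant_lebesgue.carrier (by simp [lebesgue])] with x h1 h2 ⟨i, hi⟩
  rw [mul_apply_eq_comp, h1, Function.comp_apply, h2, Function.comp_apply,
    T.inverse_toFun_toFun hi, one_apply_eq_self]

theorem koopman_mem_unitary : T.koopman ∈ unitary (Hilbert →L[ℂ] Hilbert) := by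
  refine Unitary.mem_iff.2 ⟨T.star_koopman_mul_koopman, ?_⟩
  rw [left_inv_eq_right_inv T.star_koopman_mul_koopman T.koopman_mul_koopman_inverse,
    koopman_mul_koopman_inverse]

theorem star_koopman_indicatorVec {s t : Set ℝ} (hs : MeasurableSet s) (ht : MeasurableSet t)
    (h : T.toFun ⁻¹' t =ᵐ[lebesgue] s) :
    star T.koopman (indicatorVec lebesgue hs) = indicatorVec lebesgue ht := by
  rw [← indicatorVec_congr_ae (hs := T.measurable_toFun ht) h, ← koopman_indicatorVec,
    ← mul_apply_eq_comp, star_koopman_mul_koopman, one_apply_eq_self]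

theorem indicatorOp_preimage {s : Set ℝ} (hs : MeasurableSet s) :
    indicatorOp lebesgue (T.measurable_toFun hs) =
      T.koopman * indicatorOp lebesgue hs * star T.koopman := by
  rw [koopman_mul_indicatorOp, mul_assoc, Unitary.mul_star_self_of_mem T.koopman_mem_unitary,
    mul_one]

end Koopman

section Algebra

theorem charOp_eq_indicatorOp (i : Fin n) :
    T.charOp i = indicatorOp lebesgue (T.measurableSet_interval i) :=
  rfl

theorem cstarAlgebra_le {S : StarSubalgebra ℂ (Hilbert →L[ℂ] Hilbert)}
    (hS : IsClosed (S : Set (Hilbert →L[ℂ] Hilbert))) (hu : T.koopman ∈ S)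
    (hc : ∀ i, T.charOp i ∈ S) : T.cstarAlgebra ≤ S := by
  refine StarSubalgebra.topologicalClosure_minimal (StarAlgebra.adjoin_le ?_) hS
  rintro a (rfl | ⟨i, rfl⟩)
  · exact star_mem hu
  · exact hc i

theorem koopman_mem : T.koopman ∈ T.cstarAlgebra := by
  have hu : T.unitaryOp ∈ T.cstarAlgebra := StarSubalgebra.le_topologicalClosure _
    (StarAlgebra.subset_adjoin ℂ _ (Set.mem_insert _ _))
  exact star_star T.koopman ▸ star_mem hu

theorem charOp_mem (i : Fin n) : T.charOp i ∈ T.cstarAlgebra :=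
  StarSubalgebra.le_topologicalClosure _
    (StarAlgebra.subset_adjoin ℂ _ (Set.mem_insert_of_mem _ (Set.mem_range_self i)))

end Algebra

end IntervalExchange

section ReducingOps

variable {H : Type*} [NormedAddCommGroup H] [InnerProductSpace ℂ H] [CompleteSpace H]

/-- The operators for which a subspace is reducing: it is invariant under them and their
adjoints. -/
def reducingOps (W : Submodule ℂ H) : StarSubalgebra ℂ (H →L[ℂ] H) where
  carrier := {a | ∀ w ∈ W, a w ∈ W ∧ star a w ∈ W}
  mul_mem' {a b} ha hb w hw := by
    rw [star_mul]
    exact ⟨(ha _ (hb w hw).1).1, (hb _ (ha w hw).2).2⟩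
  add_mem' {a b} ha hb w hw := by
    rw [star_add]
    exact ⟨W.add_mem (ha w hw).1 (hb w hw).1, W.add_mem (ha w hw).2 (hb w hw).2⟩
  algebraMap_mem' c w hw := by
    rw [Algebra.algebraMap_eq_smul_one, star_smul, star_one]
    exact ⟨W.smul_mem _ hw, W.smul_mem _ hw⟩
  star_mem' {a} ha w hw := by
    rw [star_star]
    exact (ha w hw).symm

theorem isClosed_reducingOps {W : Submodule ℂ H} (hW : IsClosed (W : Set H)) :
    IsClosed (reducingOps W : Set (H →L[ℂ] H)) := by
  have happly (w : H) : Continuous fun a : H →L[ℂ] H => a w := by fun_prop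
  have hinter : (reducingOps W : Set (H →L[ℂ] H)) =
      ⋂ w ∈ W, {a : H →L[ℂ] H | a w ∈ W} ∩ {a : H →L[ℂ] H | star a w ∈ W} := by
    ext a
    simp only [Set.mem_iInter]
    rfl
  rw [hinter]
  exact isClosed_biInter fun w _ => (hW.preimage (happly w)).inter
    (hW.preimage ((happly w).comp continuous_star))

theorem mem_reducingOps_span {S : Set H} {a : H →L[ℂ] H}
    (h : ∀ w ∈ S, a w ∈ Submodule.span ℂ S ∧ star a w ∈ Submodule.span ℂ S) :
    a ∈ reducingOps (Submodule.span ℂ S) := by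
  have hle : Submodule.span ℂ S ≤ (Submodule.span ℂ S).comap a.toLinearMap ⊓
      (Submodule.span ℂ S).comap (star a).toLinearMap := Submodule.span_le.2 h
  exact fun w hw => hle hw

end ReducingOps

section Atom

variable {β : Type*} [MeasurableSpace β] [MeasurableSingletonClass β] {ν : Measure β}
  {g : β → β} {c : β}

theorem mem_periodicPts_of_measure_singleton_ne_zero [IsFiniteMeasure ν]
    (hg : MeasurePreserving g ν ν) (hc : ν {c} ≠ 0) : c ∈ Function.periodicPts g := by
  obtain ⟨_, rfl, m, hm, h⟩ :=
    hg.exists_mem_iterate_mem (measurableSet_singleton c).nullMeasurableSet hc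
  exact Function.mk_mem_periodicPts (Nat.pos_of_ne_zero hm) h

theorem measure_singleton_le_measure_singleton_iterate (hg : MeasurePreserving g ν ν) (k : ℕ)
    (c : β) : ν {c} ≤ ν {g^[k] c} :=
  calc ν {c} ≤ ν (g^[k] ⁻¹' {g^[k] c}) := measure_mono (by simp)
    _ = ν {g^[k] c} :=
        (hg.iterate k).measure_preimage (measurableSet_singleton _).nullMeasurableSet

theorem preimage_singleton_apply_ae_eq [IsFiniteMeasure ν] (hg : MeasurePreserving g ν ν)
    (hc : c ∈ Function.periodicPts g) : g ⁻¹' {g c} =ᵐ[ν] ({c} : Set β) := by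
  obtain ⟨p, hp, hper⟩ := hc
  have hreturn : g^[p - 1] (g c) = c := by
    rw [← Function.iterate_succ_apply, Nat.succ_eq_add_one, Nat.sub_add_cancel hp]
    exact hper
  refine (ae_eq_of_subset_of_measure_ge (by simp : {c} ⊆ g ⁻¹' {g c}) ?_
    (measurableSet_singleton c).nullMeasurableSet (measure_ne_top _ _)).symm
  calc ν (g ⁻¹' {g c}) = ν {g c} :=
        hg.measure_preimage (measurableSet_singleton _).nullMeasurableSet
    _ ≤ ν {g^[p - 1] (g c)} := measure_singleton_le_measure_singleton_iterate hg _ _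
    _ = ν {c} := by rw [hreturn]

end Atom

namespace IntervalExchange

variable {n : ℕ} {T : IntervalExchange n}

theorem IsStationary.eq_bot_of_reducing (hn : 2 ≤ n) (hT : T.IsStationary)
    {W : Submodule ℂ Hilbert} [FiniteDimensional ℂ W] (hu : T.koopman ∈ reducingOps W)
    (hc : ∀ i, T.charOp i ∈ reducingOps W) : W = ⊥ := by
  have hle := T.cstarAlgebra_le (isClosed_reducingOps W.closed_of_finiteDimensional) hu hc
  let ρ : T.cstarAlgebra →+* Module.End ℂ W :=
    { toFun a := (a : Hilbert →L[ℂ] Hilbert).toLinearMap.restrict fun w hw => (hle a.2 w hw).1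
      map_one' := rfl
      map_mul' _ _ := rfl
      map_zero' := rfl
      map_add' _ _ := rfl }
  exact Submodule.subsingleton_iff_eq_bot.1 (hT.subsingleton_of_representation hn ρ)

section Itinerary

variable (T)

/-- The coding of the orbit of a point: which of the intervals its iterates lie in. -/
def itinerary (x : ℝ) : ℕ → Fin n → Prop :=
  fun k i => T.toFun^[k] x ∈ T.interval i

/-- The shift map on codings. -/
def shift (c : ℕ → Fin n → Prop) : ℕ → Fin n → Prop :=
  fun k => c (k + 1)

theorem measurable_itinerary : Measurable T.itinerary :=
  measurable_pi_lambda _ fun k => measurable_pi_lambda _ fun i =>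
    measurable_mem.2 (T.measurable_toFun.iterate k (T.measurableSet_interval i))

theorem measurable_shift : Measurable (shift (n := n)) :=
  measurable_pi_lambda _ fun k => measurable_pi_apply (k + 1)

theorem semiconj_itinerary : Function.Semiconj T.itinerary T.toFun shift := fun _ => rfl

theorem measurePreserving_shift {μ : Measure ℝ} (hμ : MeasurePreserving T.toFun μ μ) :
    MeasurePreserving shift (μ.map T.itinerary) (μ.map T.itinerary) :=
  (T.measurable_itinerary.measurePreserving μ).of_semiconj hμ T.semiconj_itinerary measurable_shift

/-- The characteristic function of the set of points with itinerary `c`. -/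
noncomputable def cellVec (c : ℕ → Fin n → Prop) : Hilbert :=
  indicatorVec lebesgue (T.measurable_itinerary (measurableSet_singleton c))

theorem toFun_preimage_cell_ae_eq {c : ℕ → Fin n → Prop} (hc : c ∈ Function.periodicPts shift) :
    T.toFun ⁻¹' (T.itinerary ⁻¹' {shift c}) =ᵐ[lebesgue] T.itinerary ⁻¹' {c} :=
  T.measurable_itinerary.measurePreserving lebesgue |>.quasiMeasurePreserving.preimage_ae_eq
    (preimage_singleton_apply_ae_eq (T.measurePreserving_shift T.measurePreserving) hc)

theorem koopman_cellVec {c : ℕ → Fin n → Prop} (hc : c ∈ Function.periodicPts shift) :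
    T.koopman (T.cellVec (shift c)) = T.cellVec c :=
  (T.koopman_indicatorVec _).trans (indicatorVec_congr_ae (T.toFun_preimage_cell_ae_eq hc))

theorem star_koopman_cellVec {c : ℕ → Fin n → Prop} (hc : c ∈ Function.periodicPts shift) :
    star T.koopman (T.cellVec c) = T.cellVec (shift c) :=
  T.star_koopman_indicatorVec _ _ (T.toFun_preimage_cell_ae_eq hc)

theorem charOp_cellVec_of_apply {c : ℕ → Fin n → Prop} {i : Fin n} (hc : c 0 i) :
    T.charOp i (T.cellVec c) = T.cellVec c := by
  have hcell : T.interval i ∩ T.itinerary ⁻¹' {c} = T.itinerary ⁻¹' {c} :=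
    Set.inter_eq_right.2 fun x hx => (congrFun₂ hx 0 i).mpr hc
  exact (indicatorOp_indicatorVec _ _).trans (indicatorVec_congr_ae (.of_eq hcell))

theorem charOp_cellVec_of_not_apply {c : ℕ → Fin n → Prop} {i : Fin n} (hc : ¬c 0 i) :
    T.charOp i (T.cellVec c) = 0 := by
  have hcell : T.interval i ∩ T.itinerary ⁻¹' {c} = ∅ :=
    Set.eq_empty_of_forall_notMem fun x hx => hc ((congrFun₂ hx.2 0 i).mp hx.1)
  exact (indicatorOp_indicatorVec _ _).trans (indicatorVec_eq_zero.2 (hcell ▸ measure_empty))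

variable {T}

theorem IsStationary.cellVec_eq_zero (hn : 2 ≤ n) (hT : T.IsStationary) {c : ℕ → Fin n → Prop}
    (hc : c ∈ Function.periodicPts shift) : T.cellVec c = 0 := by
  let p := Function.minimalPeriod shift c
  let v : ℕ → Hilbert := fun m => T.cellVec (shift^[m] c)
  have hp : 0 < p := Function.minimalPeriod_pos_of_mem_periodicPts hc
  have hperiodic (m : ℕ) : shift^[m] c ∈ Function.periodicPts shift :=
    (Function.Commute.iterate_self shift m).semiconj.mapsTo_periodicPts hc
  have hv : Function.Periodic v p := fun m =>
    congrArg T.cellVec Function.iterate_add_minimalPeriod_eq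
  have hkoopman (m : ℕ) : T.koopman (v (m + 1)) = v m := by
    simp only [v, Function.iterate_succ_apply', T.koopman_cellVec (hperiodic m)]
  have hstar (m : ℕ) : star T.koopman (v m) = v (m + 1) := by
    simp only [v, Function.iterate_succ_apply', T.star_koopman_cellVec (hperiodic m)]
  have hmem (m : ℕ) : v m ∈ Submodule.span ℂ (Set.range v) := Submodule.subset_span ⟨m, rfl⟩
  have hfinite : (Set.range v).Finite :=
    ((Set.finite_Iio p).image v).subset <| Set.range_subset_iff.2 fun m =>
      ⟨m % p, Nat.mod_lt _ hp, hv.map_mod_nat m⟩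
  have := FiniteDimensional.span_of_finite ℂ hfinite
  have hbot : Submodule.span ℂ (Set.range v) = ⊥ := by
    refine hT.eq_bot_of_reducing hn (mem_reducingOps_span ?_) fun i => mem_reducingOps_span ?_
    · rintro _ ⟨m, rfl⟩
      rw [hstar, ← hv m, ← Nat.sub_add_cancel (Nat.add_pos_right m hp), hkoopman]
      exact ⟨hmem _, hmem _⟩
    · rintro _ ⟨m, rfl⟩
      have hi : T.charOp i (v m) ∈ Submodule.span ℂ (Set.range v) := by
        by_cases h : shift^[m] c 0 i
        · exact (T.charOp_cellVec_of_apply h).symm ▸ hmem m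
        · exact (T.charOp_cellVec_of_not_apply h).symm ▸ Submodule.zero_mem _
      rw [charOp_eq_indicatorOp, (isSelfAdjoint_indicatorOp _).star_eq, ← charOp_eq_indicatorOp]
      exact ⟨hi, hi⟩
  exact (Submodule.mem_bot ℂ).1 (hbot ▸ hmem 0)

theorem IsStationary.lebesgue_itinerary_preimage_singleton (hn : 2 ≤ n) (hT : T.IsStationary)
    (c : ℕ → Fin n → Prop) : lebesgue (T.itinerary ⁻¹' {c}) = 0 := by
  by_contra hne
  rw [← Measure.map_apply T.measurable_itinerary (measurableSet_singleton c)] at hne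
  have hper := mem_periodicPts_of_measure_singleton_ne_zero
    (T.measurePreserving_shift T.measurePreserving) hne
  rw [Measure.map_apply T.measurable_itinerary (measurableSet_singleton c)] at hne
  exact hne (indicatorVec_eq_zero.1 (hT.cellVec_eq_zero hn hper))

end Itinerary

end IntervalExchange

section MeanState

open Filter Topology
open scoped ComplexOrder InnerProductSpace

variable {X H : Type*} [MeasurableSpace X] [NormedAddCommGroup H] [InnerProductSpace ℂ H]
  {ξ : ℕ → X → H} {μ : Measure X}

/-- A bounded functional on the operators is a mean state for a sequence of vector fields on a
measure space if it is the limit, along the fixed ultrafilter `hyperfilter ℕ`, of the averages of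
the matrix coefficients at the vectors of these fields. -/
def IsMeanState (ξ : ℕ → X → H) (μ : Measure X) (τ : StrongDual ℂ (H →L[ℂ] H)) : Prop :=
  ∀ a, Tendsto (fun m => ∫ x, ⟪ξ m x, a (ξ m x)⟫_ℂ ∂μ) (hyperfilter ℕ : Filter ℕ) (𝓝 (τ a))

theorem stronglyMeasurable_inner_apply {v : X → H} (hv : StronglyMeasurable v) (a : H →L[ℂ] H) :
    StronglyMeasurable fun x => ⟪v x, a (v x)⟫_ℂ :=
  hv.inner (a.continuous.comp_stronglyMeasurable hv)

theorem norm_inner_apply_le {v : H} (hv : ‖v‖ ≤ 1) (a : H →L[ℂ] H) : ‖⟪v, a v⟫_ℂ‖ ≤ ‖a‖ :=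
  calc ‖⟪v, a v⟫_ℂ‖ ≤ ‖v‖ * ‖a v‖ := norm_inner_le_norm _ _
    _ ≤ 1 * ‖a‖ := by
      gcongr
      exact a.unit_le_opNorm v hv
    _ = ‖a‖ := one_mul _

theorem integrable_inner_apply [IsFiniteMeasure μ] {v : X → H} (hv : StronglyMeasurable v)
    (hv1 : ∀ x, ‖v x‖ ≤ 1) (a : H →L[ℂ] H) : Integrable (fun x => ⟪v x, a (v x)⟫_ℂ) μ :=
  .of_bound (stronglyMeasurable_inner_apply hv a).aestronglyMeasurable ‖a‖
    (ae_of_all _ fun x => norm_inner_apply_le (hv1 x) a)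

theorem exists_isMeanState [IsProbabilityMeasure μ] (hξ : ∀ m, StronglyMeasurable (ξ m))
    (hξ1 : ∀ m x, ‖ξ m x‖ ≤ 1) : ∃ τ, IsMeanState ξ μ τ := by
  let mean (m : ℕ) : StrongDual ℂ (H →L[ℂ] H) := LinearMap.mkContinuous
    { toFun a := ∫ x, ⟪ξ m x, a (ξ m x)⟫_ℂ ∂μ
      map_add' a b := by
        rw [← integral_add (integrable_inner_apply (hξ m) (hξ1 m) a)
          (integrable_inner_apply (hξ m) (hξ1 m) b)]
        simp only [add_apply, inner_add_right]
      map_smul' c a := by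
        simp only [smul_apply, inner_smul_right, integral_const_mul, RingHom.id_apply,
          smul_eq_mul] }
    1 fun a => by
      rw [one_mul]
      refine (norm_integral_le_of_norm_le_const
        (ae_of_all _ fun x => norm_inner_apply_le (hξ1 m x) a)).trans_eq ?_
      rw [probReal_univ, mul_one]
  have hmean (m : ℕ) : mean m ∈ Metric.closedBall (0 : StrongDual ℂ (H →L[ℂ] H)) 1 :=
    (mem_closedBall_zero_iff (E := StrongDual ℂ (H →L[ℂ] H))).2
      (LinearMap.mkContinuous_norm_le _ zero_le_one _)
  obtain ⟨τ, -, hτ⟩ := (WeakDual.isCompact_closedBall (0 : StrongDual ℂ (H →L[ℂ] H)) 1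
    ).ultrafilter_le_nhds ((hyperfilter ℕ).map fun m => StrongDual.toWeakDual (mean m))
      (le_principal_iff.2 (Ultrafilter.mem_map.2 (univ_mem' hmean)))
  exact ⟨WeakDual.toStrongDual τ, fun a => ((WeakDual.eval_continuous a).tendsto τ).comp hτ⟩

namespace IsMeanState

variable {τ : StrongDual ℂ (H →L[ℂ] H)} {a b U : H →L[ℂ] H} {ψ : X → X}

theorem map_star [CompleteSpace H] (hτ : IsMeanState ξ μ τ) (a : H →L[ℂ] H) :
    τ (star a) = star (τ a) := by
  refine tendsto_nhds_unique (hτ (star a)) (((continuous_star.tendsto _).comp (hτ a)).congr ?_)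
  intro m
  rw [Function.comp_apply, ← starRingEnd_apply, ← integral_conj]
  simp only [inner_conj_symm, ContinuousLinearMap.star_eq_adjoint,
    ContinuousLinearMap.adjoint_inner_right]

theorem map_star_mul_self_nonneg [CompleteSpace H] (hτ : IsMeanState ξ μ τ) (a : H →L[ℂ] H) :
    0 ≤ τ (star a * a) := by
  refine ge_of_tendsto (hτ (star a * a)) (Eventually.of_forall fun m => ?_)
  refine integral_nonneg fun x => ?_
  have hinner : ⟪ξ m x, (star a * a) (ξ m x)⟫_ℂ = (‖a (ξ m x)‖ ^ 2 : ℝ) := by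
    rw [mul_apply_eq_comp, ContinuousLinearMap.star_eq_adjoint,
      ContinuousLinearMap.adjoint_inner_right, inner_self_eq_norm_sq_to_K, Complex.ofReal_pow]
    rfl
  simp only [Pi.zero_apply, hinner, Complex.zero_le_real, sq_nonneg]

theorem map_eq_of_eventuallyEq_comp [IsFiniteMeasure μ] (hξ : ∀ m, StronglyMeasurable (ξ m))
    (hξ1 : ∀ m x, ‖ξ m x‖ ≤ 1) (hτ : IsMeanState ξ μ τ) (hψ : MeasurePreserving ψ μ μ)
    (h : ∀ᵐ x ∂μ, ∀ᶠ m in atTop,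
      ⟪ξ m x, a (ξ m x)⟫_ℂ = ⟪ξ m (ψ x), b (ξ m (ψ x))⟫_ℂ) : τ a = τ b := by
  have ha (m : ℕ) := integrable_inner_apply (μ := μ) (hξ m) (hξ1 m) a
  have hb (m : ℕ) := integrable_inner_apply (μ := μ) (hξ m) (hξ1 m) b
  have hbψ (m : ℕ) : Integrable (fun x => ⟪ξ m (ψ x), b (ξ m (ψ x))⟫_ℂ) μ :=
    hψ.integrable_comp_of_integrable (hb m)
  have hzero : Tendsto
      (fun m => ∫ x, (⟪ξ m x, a (ξ m x)⟫_ℂ - ⟪ξ m (ψ x), b (ξ m (ψ x))⟫_ℂ) ∂μ) atTop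
      (𝓝 (∫ _, (0 : ℂ) ∂μ)) := by
    refine tendsto_integral_of_dominated_convergence (fun _ => ‖a‖ + ‖b‖)
      (fun m => ((ha m).sub (hbψ m)).aestronglyMeasurable) (integrable_const _)
      (fun m => ae_of_all _ fun x => norm_sub_le_of_le (norm_inner_apply_le (hξ1 m x) a)
        (norm_inner_apply_le (hξ1 m (ψ x)) b)) ?_
    filter_upwards [h] with x hx
    exact tendsto_const_nhds.congr' (hx.mono fun m hm => (sub_eq_zero.2 hm).symm)
  rw [integral_zero] at hzero
  refine sub_eq_zero.1 (tendsto_nhds_unique ((hτ a).sub (hτ b))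
    ((hzero.mono_left Nat.hyperfilter_le_atTop).congr fun m => ?_))
  rw [integral_sub (ha m) (hbψ m)]
  congr 1
  conv_rhs => rw [← hψ.map_eq]
  exact (integral_map hψ.aemeasurable
    (stronglyMeasurable_inner_apply (hξ m) b).aestronglyMeasurable).symm

theorem map_conj_eq [CompleteSpace H] [IsFiniteMeasure μ] (hξ : ∀ m, StronglyMeasurable (ξ m))
    (hξ1 : ∀ m x, ‖ξ m x‖ ≤ 1) (hτ : IsMeanState ξ μ τ) (hψ : MeasurePreserving ψ μ μ)
    (hU : ∀ᵐ x ∂μ, ∀ᶠ m in atTop, star U (ξ m x) = ξ m (ψ x)) (a : H →L[ℂ] H) :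
    τ (U * a * star U) = τ a := by
  refine hτ.map_eq_of_eventuallyEq_comp hξ hξ1 hψ (hU.mono fun x hx => hx.mono fun m hm => ?_)
  rw [mul_apply_eq_comp, mul_apply_eq_comp, hm, ← ContinuousLinearMap.adjoint_inner_left,
    ← ContinuousLinearMap.star_eq_adjoint, hm]

theorem map_mul_comm_of_unitary [CompleteSpace H] [IsFiniteMeasure μ]
    (hξ : ∀ m, StronglyMeasurable (ξ m)) (hξ1 : ∀ m x, ‖ξ m x‖ ≤ 1) (hτ : IsMeanState ξ μ τ)
    (hψ : MeasurePreserving ψ μ μ) (hUmem : U ∈ unitary (H →L[ℂ] H))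
    (hU : ∀ᵐ x ∂μ, ∀ᶠ m in atTop, star U (ξ m x) = ξ m (ψ x)) (a : H →L[ℂ] H) :
    τ (a * U) = τ (U * a) := by
  rw [← hτ.map_conj_eq hξ hξ1 hψ hU (a * U), ← mul_assoc, mul_assoc,
    Unitary.mul_star_self_of_mem hUmem, mul_one]

end IsMeanState

/-- An operator acts diagonally on a sequence of vector fields, with eigenvalue function `g`, if at
almost every point the vectors of these fields are eventually eigenvectors for the value of `g`. -/
def ActsDiagonally (ξ : ℕ → X → H) (μ : Measure X) (a : H →L[ℂ] H) (g : X → ℂ) : Prop :=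
  ∀ᵐ x ∂μ, ∀ᶠ m in atTop, a (ξ m x) = g x • ξ m x

namespace ActsDiagonally

variable {a b U : H →L[ℂ] H} {f g : X → ℂ} {ψ : X → X}

theorem one : ActsDiagonally ξ μ 1 1 :=
  ae_of_all _ fun _ => Eventually.of_forall fun _ => (one_smul _ _).symm

theorem sub (ha : ActsDiagonally ξ μ a f) (hb : ActsDiagonally ξ μ b g) :
    ActsDiagonally ξ μ (a - b) (f - g) := by
  filter_upwards [ha, hb] with x hxa hxb
  filter_upwards [hxa, hxb] with m hma hmb
  rw [sub_apply, hma, hmb, Pi.sub_apply, sub_smul]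

theorem mul (ha : ActsDiagonally ξ μ a f) (hb : ActsDiagonally ξ μ b g) :
    ActsDiagonally ξ μ (a * b) (f * g) := by
  filter_upwards [ha, hb] with x hxa hxb
  filter_upwards [hxa, hxb] with m hma hmb
  rw [mul_apply_eq_comp, hmb, map_smul, hma, Pi.mul_apply, smul_smul, mul_comm]

theorem conj [CompleteSpace H] (ha : ActsDiagonally ξ μ a g)
    (hψ : Measure.QuasiMeasurePreserving ψ μ μ) (hUmem : U ∈ unitary (H →L[ℂ] H))
    (hU : ∀ᵐ x ∂μ, ∀ᶠ m in atTop, star U (ξ m x) = ξ m (ψ x)) :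
    ActsDiagonally ξ μ (U * a * star U) (g ∘ ψ) := by
  filter_upwards [hψ.ae ha, hU] with x hxa hxU
  filter_upwards [hxa, hxU] with m hma hmU
  rw [mul_apply_eq_comp, mul_apply_eq_comp, hmU, hma, map_smul, ← hmU, ← mul_apply_eq_comp,
    Unitary.mul_star_self_of_mem hUmem, one_apply_eq_self, Function.comp_apply]

theorem map_eq_integral [IsFiniteMeasure μ] (hξ : ∀ m, StronglyMeasurable (ξ m))
    (hξ1 : ∀ m x, ‖ξ m x‖ ≤ 1) {τ : StrongDual ℂ (H →L[ℂ] H)} (hτ : IsMeanState ξ μ τ)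
    (hnorm : ∀ᵐ x ∂μ, ∀ᶠ m in atTop, ‖ξ m x‖ = 1) (ha : ActsDiagonally ξ μ a g) :
    τ a = ∫ x, g x ∂μ := by
  refine tendsto_nhds_unique (hτ a) (Tendsto.mono_left ?_ Nat.hyperfilter_le_atTop)
  refine tendsto_integral_of_dominated_convergence (fun _ => ‖a‖)
    (fun m => (stronglyMeasurable_inner_apply (hξ m) a).aestronglyMeasurable) (integrable_const _)
    (fun m => ae_of_all _ fun x => norm_inner_apply_le (hξ1 m x) a) ?_
  filter_upwards [ha, hnorm] with x hxa hx1
  refine tendsto_const_nhds.congr' ((hxa.and hx1).mono fun m ⟨hma, hm1⟩ => ?_)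
  simp only [hma, inner_smul_right, inner_self_eq_norm_sq_to_K, hm1, Complex.coe_algebraMap,
    Complex.ofReal_one, one_pow, mul_one]

theorem map_mul_comm [CompleteSpace H] [IsFiniteMeasure μ] (hξ : ∀ m, StronglyMeasurable (ξ m))
    (hξ1 : ∀ m x, ‖ξ m x‖ ≤ 1) {τ : StrongDual ℂ (H →L[ℂ] H)} (hτ : IsMeanState ξ μ τ)
    (ha : ActsDiagonally ξ μ a g) (ha' : ActsDiagonally ξ μ (star a) (star g)) (b : H →L[ℂ] H) :
    τ (b * a) = τ (a * b) := by
  refine hτ.map_eq_of_eventuallyEq_comp hξ hξ1 (MeasurePreserving.id μ) ?_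
  filter_upwards [ha, ha'] with x hx hx'
  filter_upwards [hx, hx'] with m hm hm'
  rw [mul_apply_eq_comp, mul_apply_eq_comp, hm, map_smul, inner_smul_right, id,
    ← a.adjoint_inner_left, ← ContinuousLinearMap.star_eq_adjoint, hm',
    inner_smul_left, Pi.star_apply, starRingEnd_apply, star_star]

end ActsDiagonally

end MeanState

section TracialCentralizer

variable {A : Type*} [NormedRing A] [NormedAlgebra ℂ A] [StarRing A] [StarModule ℂ A]

/-- The elements that commute with all others under a hermitian functional. -/
def tracialCentralizer (τ : StrongDual ℂ A) (hτ : ∀ a, τ (star a) = star (τ a)) :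
    StarSubalgebra ℂ A where
  carrier := {b | ∀ a, τ (a * b) = τ (b * a)}
  mul_mem' {b c} hb hc a := by rw [← mul_assoc, hc, ← mul_assoc, hb, mul_assoc]
  add_mem' {b c} hb hc a := by rw [mul_add, add_mul, map_add, map_add, hb, hc]
  algebraMap_mem' c a := by rw [Algebra.commutes]
  star_mem' {b} hb a := by
    have h : τ (star (b * star a)) = τ (star (star a * b)) := by rw [hτ, hτ, hb]
    simpa only [star_mul, star_star] using h

theorem isClosed_tracialCentralizer (τ : StrongDual ℂ A) (hτ : ∀ a, τ (star a) = star (τ a)) :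
    IsClosed (tracialCentralizer τ hτ : Set A) := by
  have hinter : (tracialCentralizer τ hτ : Set A) = ⋂ a, {b | τ (a * b) = τ (b * a)} := by
    ext b
    simp only [Set.mem_iInter]
    rfl
  rw [hinter]
  exact isClosed_iInter fun a => isClosed_eq (by fun_prop) (by fun_prop)

end TracialCentralizer

section Order

variable {α : Type*} [LinearOrder α]

theorem symmDiff_Ioo_subset_uIcc_union_uIcc (a b c d : α) :
    symmDiff (Set.Ioo a b) (Set.Ioo c d) ⊆ Set.uIcc a c ∪ Set.uIcc b d := by
  intro z
  simp only [Set.mem_symmDiff, Set.mem_union, Set.mem_Ioo, Set.mem_uIcc]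
  grind

end Order

namespace IntervalExchange

open Filter Topology

section Probe

/-- The normalized characteristic function of a short interval at `x`, which is one-sided if
`r = 0` and symmetric if `r = 1`. -/
noncomputable def probe (r h x : ℝ) : Hilbert :=
  (√((1 + r) * h) : ℂ)⁻¹ • indicatorVec lebesgue (measurableSet_Ioo (a := x - r * h) (b := x + h))

theorem continuous_probe (r h : ℝ) : Continuous (probe r h) := by
  suffices Continuous fun x : ℝ =>
      indicatorVec lebesgue (measurableSet_Ioo (a := x - r * h) (b := x + h)) from
    (continuous_const_smul _).comp this
  refine continuous_indicatorConstLp_set (hs := fun _ => measurableSet_Ioo)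
    (hμs := fun _ => measure_ne_top _ _) ENNReal.ofNat_ne_top fun x => ?_
  have hle (y : ℝ) : lebesgue (symmDiff (Set.Ioo (y - r * h) (y + h)) (Set.Ioo (x - r * h) (x + h)))
      ≤ ENNReal.ofReal |x - y| + ENNReal.ofReal |x - y| :=
    calc _ ≤ volume (Set.uIcc (y - r * h) (x - r * h) ∪ Set.uIcc (y + h) (x + h)) :=
          (measure_mono (symmDiff_Ioo_subset_uIcc_union_uIcc _ _ _ _)).trans
            (Measure.restrict_apply_le _ _)
      _ ≤ volume (Set.uIcc (y - r * h) (x - r * h)) + volume (Set.uIcc (y + h) (x + h)) :=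
          measure_union_le _ _
      _ = ENNReal.ofReal |x - y| + ENNReal.ofReal |x - y| := by
          rw [Real.volume_interval, Real.volume_interval, sub_sub_sub_cancel_right,
            add_sub_add_right_eq_sub]
  refine tendsto_of_tendsto_of_tendsto_of_le_of_le tendsto_const_nhds ?_ (fun _ => zero_le) hle
  have hcont : Continuous fun y : ℝ => ENNReal.ofReal |x - y| :=
    ENNReal.continuous_ofReal.comp (by fun_prop)
  simpa using (hcont.fun_add hcont).tendsto x

variable {r h x : ℝ}

theorem norm_probe_sq (hr : 0 ≤ r) (hh : 0 < h) :
    ‖probe r h x‖ ^ 2 = ((1 + r) * h)⁻¹ * lebesgue.real (Set.Ioo (x - r * h) (x + h)) := by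
  rw [probe, norm_smul, mul_pow, norm_indicatorVec_sq, norm_inv, inv_pow, Complex.norm_real,
    Real.norm_of_nonneg (Real.sqrt_nonneg _), Real.sq_sqrt (by positivity)]

theorem norm_probe_le_one (hr : 0 ≤ r) (hh : 0 < h) : ‖probe r h x‖ ≤ 1 := by
  have hlength : lebesgue.real (Set.Ioo (x - r * h) (x + h)) ≤ (1 + r) * h :=
    calc _ ≤ volume.real (Set.Ioo (x - r * h) (x + h)) :=
          ENNReal.toReal_mono measure_Ioo_lt_top.ne (Measure.restrict_apply_le _ _)
      _ = (1 + r) * h := by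
          rw [Real.volume_real_Ioo_of_le (by nlinarith)]
          ring
  rw [← sq_le_one_iff₀ (norm_nonneg _), norm_probe_sq hr hh]
  exact inv_mul_le_one_of_le₀ hlength (by positivity)

theorem lebesgue_Ioo {a b : ℝ} (hsub : Set.Ioo a b ⊆ Set.Ico 0 1) :
    lebesgue (Set.Ioo a b) = ENNReal.ofReal (b - a) := by
  rw [lebesgue, Measure.restrict_eq_self _ hsub, Real.volume_Ioo]

theorem norm_probe_eq_one (hr : 0 ≤ r) (hh : 0 < h)
    (hsub : Set.Ioo (x - r * h) (x + h) ⊆ Set.Ico 0 1) : ‖probe r h x‖ = 1 := by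
  have hpos : 0 < (1 + r) * h := by positivity
  have hlength : x + h - (x - r * h) = (1 + r) * h := by ring
  rw [← sq_eq_sq₀ (norm_nonneg _) zero_le_one, norm_probe_sq hr hh, measureReal_def,
    lebesgue_Ioo hsub, hlength, ENNReal.toReal_ofReal hpos.le, inv_mul_cancel₀ hpos.ne', one_pow]

variable {n : ℕ} {T : IntervalExchange n} {i : Fin n}

theorem charOp_probe_of_subset (hx : x ∈ T.interval i)
    (hsub : Set.Ioo (x - r * h) (x + h) ⊆ T.interval i) (j : Fin n) :
    T.charOp j (probe r h x) = (T.interval j).indicator (1 : ℝ → ℂ) x • probe r h x := by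
  rw [probe, map_smul, charOp_eq_indicatorOp, indicatorOp_indicatorVec, smul_comm]
  congr 1
  by_cases hij : i = j
  · subst hij
    simp only [Set.inter_eq_right.2 hsub, Set.indicator_of_mem hx, Pi.one_apply, one_smul]
  · have hd := T.disjoint_interval hij
    rw [Set.indicator_of_notMem (Set.disjoint_left.1 hd hx), zero_smul, indicatorVec_eq_zero,
      (hd.mono_left hsub).symm.inter_eq, measure_empty]

theorem Ioo_subset_preimage_toFun (hx : x ∈ T.interval i)
    (hr : r = 0 ∧ T.sign i = 1 ∨ r = 1) (hsub : Set.Ioo (x - r * h) (x + h) ⊆ T.interval i) :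
    Set.Ioo (x - r * h) (x + h) ⊆
      T.toFun ⁻¹' Set.Ioo (T.toFun x - r * h) (T.toFun x + h) := by
  intro y hy
  rw [Set.mem_preimage, T.toFun_eq i hx, T.toFun_eq i (hsub hy)]
  simp only [piece]
  rcases hr with ⟨rfl, hs⟩ | rfl
  · rw [if_pos hs, if_pos hs]
    constructor <;> linarith [hy.1, hy.2]
  · split_ifs <;> constructor <;> linarith [hy.1, hy.2]

theorem star_koopman_probe (hx : x ∈ T.interval i) (hr : r = 0 ∧ T.sign i = 1 ∨ r = 1)
    (hsub : Set.Ioo (x - r * h) (x + h) ⊆ T.interval i) :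
    star T.koopman (probe r h x) = probe r h (T.toFun x) := by
  rw [probe, map_smul, probe]
  congr 1
  refine T.star_koopman_indicatorVec _ _ (ae_eq_of_subset_of_measure_ge
    (Ioo_subset_preimage_toFun hx hr hsub) ?_ measurableSet_Ioo.nullMeasurableSet
    (measure_ne_top _ _)).symm
  calc lebesgue (T.toFun ⁻¹' Set.Ioo (T.toFun x - r * h) (T.toFun x + h))
      = lebesgue (Set.Ioo (T.toFun x - r * h) (T.toFun x + h)) :=
        T.measurePreserving.measure_preimage measurableSet_Ioo.nullMeasurableSet
    _ ≤ volume (Set.Ioo (T.toFun x - r * h) (T.toFun x + h)) := Measure.restrict_apply_le _ _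
    _ = lebesgue (Set.Ioo (x - r * h) (x + h)) := by
        rw [lebesgue_Ioo (hsub.trans (T.interval_subset_Ico i)), Real.volume_Ioo]
        congr 1
        ring

end Probe

section Regular

/-- The vector fields along which the operators are averaged. -/
noncomputable def probes (r : ℝ) (m : ℕ) : ℝ → Hilbert :=
  probe r (1 / (m + 1))

theorem stronglyMeasurable_probes (r : ℝ) (m : ℕ) : StronglyMeasurable (probes r m) :=
  (continuous_probe r _).stronglyMeasurable

theorem norm_probes_le_one {r : ℝ} (hr : 0 ≤ r) (m : ℕ) (x : ℝ) : ‖probes r m x‖ ≤ 1 :=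
  norm_probe_le_one hr Nat.one_div_pos_of_nat

variable {n : ℕ} {T : IntervalExchange n} {r x : ℝ}

/-- A point is regular if the transformation maps all short intervals at this point, one-sided or
symmetric according to `r`, onto such intervals at the image point. -/
def IsRegular (T : IntervalExchange n) (r x : ℝ) : Prop :=
  ∃ i, x ∈ T.interval i ∧ (r = 0 ∧ T.sign i = 1 ∨ r = 1 ∧ x ≠ T.left i)

theorem exists_isRegular (T : IntervalExchange n) : ∃ r : ℝ, 0 ≤ r ∧
    ∀ μ : Measure ℝ, T.IsInvariant μ → ∀ᵐ x ∂μ, T.IsRegular r x := by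
  by_cases h : ∃ i, T.sign i = -1
  · refine ⟨1, zero_le_one, fun μ hμ => ?_⟩
    filter_upwards [T.ae_mem_interior hμ.carrier (hμ.endpoints h)] with x ⟨i, hi⟩
    exact ⟨i, ⟨hi.1.le, hi.2⟩, Or.inr ⟨rfl, hi.1.ne'⟩⟩
  · refine ⟨0, le_rfl, fun μ hμ => ?_⟩
    filter_upwards [mem_ae_iff.2 hμ.carrier] with x hx
    obtain ⟨i, hi⟩ := T.exists_mem_interval hx
    exact ⟨i, hi, Or.inl ⟨rfl,
      (Int.units_eq_one_or (T.sign i)).resolve_right fun h' => h ⟨i, h'⟩⟩⟩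

theorem IsRegular.eventually_subset (hx : T.IsRegular r x) :
    ∃ i, x ∈ T.interval i ∧ (r = 0 ∧ T.sign i = 1 ∨ r = 1) ∧ ∀ᶠ m : ℕ in atTop,
      Set.Ioo (x - r * (1 / (m + 1))) (x + 1 / (m + 1)) ⊆ T.interval i := by
  obtain ⟨i, hi, hr⟩ := hx
  have hmesh := tendsto_one_div_add_atTop_nhds_zero_nat (𝕜 := ℝ)
  have hright : ∀ᶠ m : ℕ in atTop, x + 1 / (m + 1) < T.left i + T.len i :=
    (hmesh.const_add x).eventually_lt_const (by simpa using hi.2)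
  have hleft : ∀ᶠ m : ℕ in atTop, T.left i ≤ x - r * (1 / (m + 1)) := by
    rcases hr with ⟨rfl, -⟩ | ⟨rfl, hne⟩
    · exact Eventually.of_forall fun _ => by simpa using hi.1
    · refine (((hmesh.const_mul 1).const_sub x).eventually_const_lt ?_).mono fun _ => le_of_lt
      simpa using lt_of_le_of_ne hi.1 hne.symm
  refine ⟨i, hi, hr.imp_right And.left, ?_⟩
  filter_upwards [hleft, hright] with m hl hu
  exact Set.Ioo_subset_Ico_self.trans (Set.Ico_subset_Ico hl hu.le)

theorem IsRegular.eventually_norm_probes (hr : 0 ≤ r) (hx : T.IsRegular r x) :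
    ∀ᶠ m in atTop, ‖probes r m x‖ = 1 := by
  obtain ⟨i, -, -, hsub⟩ := hx.eventually_subset
  exact hsub.mono fun m hm =>
    norm_probe_eq_one hr Nat.one_div_pos_of_nat (hm.trans (T.interval_subset_Ico i))

theorem IsRegular.eventually_star_koopman_probes (hx : T.IsRegular r x) :
    ∀ᶠ m in atTop, star T.koopman (probes r m x) = probes r m (T.toFun x) := by
  obtain ⟨i, hi, hr, hsub⟩ := hx.eventually_subset
  exact hsub.mono fun m hm => star_koopman_probe hi hr hm

theorem actsDiagonally_charOp {μ : Measure ℝ} (hreg : ∀ᵐ x ∂μ, T.IsRegular r x) (j : Fin n) :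
    ActsDiagonally (probes r) μ (T.charOp j) ((T.interval j).indicator 1) := by
  filter_upwards [hreg] with x hx
  obtain ⟨i, hi, -, hsub⟩ := hx.eventually_subset
  exact hsub.mono fun m hm => charOp_probe_of_subset hi hm j

end Regular

section CodedSets

variable {n : ℕ} {T : IntervalExchange n}

/-- The Boolean algebra generated by the intervals and their iterated preimages: whether a point
belongs to such a set depends only on finitely many coordinates of its itinerary. -/
inductive IsCodedSet (T : IntervalExchange n) : Set ℝ → Prop
  | interval (i : Fin n) : IsCodedSet T (T.interval i)
  | compl {s : Set ℝ} : IsCodedSet T s → IsCodedSet T sᶜ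
  | inter {s t : Set ℝ} : IsCodedSet T s → IsCodedSet T t → IsCodedSet T (s ∩ t)
  | preimage {s : Set ℝ} : IsCodedSet T s → IsCodedSet T (T.toFun ⁻¹' s)

namespace IsCodedSet

theorem measurableSet {s : Set ℝ} (hs : T.IsCodedSet s) : MeasurableSet s := by
  induction hs with
  | interval i => exact T.measurableSet_interval i
  | compl _ ih => exact ih.compl
  | inter _ _ ih ih' => exact ih.inter ih'
  | preimage _ ih => exact T.measurable_toFun ih

theorem indicatorOp_mem {s : Set ℝ} (hs : T.IsCodedSet s) :
    indicatorOp lebesgue hs.measurableSet ∈ T.cstarAlgebra := by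
  induction hs with
  | interval i => exact T.charOp_mem i
  | compl hs ih =>
    rw [indicatorOp_compl hs.measurableSet]
    exact sub_mem (one_mem _) ih
  | inter hs ht ih ih' =>
    rw [← indicatorOp_mul hs.measurableSet ht.measurableSet]
    exact mul_mem ih ih'
  | preimage hs ih =>
    rw [T.indicatorOp_preimage hs.measurableSet]
    exact mul_mem (mul_mem T.koopman_mem ih) (star_mem T.koopman_mem)

theorem actsDiagonally {s : Set ℝ} (hs : T.IsCodedSet s) {r : ℝ} {μ : Measure ℝ}
    (hμ : MeasurePreserving T.toFun μ μ) (hreg : ∀ᵐ x ∂μ, T.IsRegular r x) :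
    ActsDiagonally (probes r) μ (indicatorOp lebesgue hs.measurableSet) (s.indicator 1) := by
  induction hs with
  | interval i => exact actsDiagonally_charOp hreg i
  | compl hs ih =>
    rw [indicatorOp_compl hs.measurableSet, Set.indicator_compl]
    exact ActsDiagonally.one.sub ih
  | inter hs ht ih ih' =>
    rw [← indicatorOp_mul hs.measurableSet ht.measurableSet, Set.inter_indicator_one]
    exact ih.mul ih'
  | preimage hs ih =>
    rw [T.indicatorOp_preimage hs.measurableSet]
    exact ih.conj hμ.quasiMeasurePreserving T.koopman_mem_unitary
      (hreg.mono fun _ => IsRegular.eventually_star_koopman_probes)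

/-- The indicator of a coded set, as an element of the C*-algebra of the transformation. -/
noncomputable def proj {s : Set ℝ} (hs : T.IsCodedSet s) : T.cstarAlgebra :=
  ⟨indicatorOp lebesgue hs.measurableSet, hs.indicatorOp_mem⟩

theorem isStarProjection_proj {s : Set ℝ} (hs : T.IsCodedSet s) : IsStarProjection hs.proj where
  isIdempotentElem := Subtype.ext (isStarProjection_indicatorOp hs.measurableSet).isIdempotentElem
  isSelfAdjoint := Subtype.ext (isStarProjection_indicatorOp hs.measurableSet).isSelfAdjoint

end IsCodedSet

end CodedSets

section InvariantTrace

variable {n : ℕ} {T : IntervalExchange n} {μ : Measure ℝ} [IsProbabilityMeasure μ] {r : ℝ}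
  {τ : StrongDual ℂ (Hilbert →L[ℂ] Hilbert)}

theorem cstarAlgebra_le_tracialCentralizer (hμ : MeasurePreserving T.toFun μ μ) (hr : 0 ≤ r)
    (hreg : ∀ᵐ x ∂μ, T.IsRegular r x) (hτ : IsMeanState (probes r) μ τ) :
    T.cstarAlgebra ≤ tracialCentralizer τ hτ.map_star := by
  refine T.cstarAlgebra_le (isClosed_tracialCentralizer τ hτ.map_star)
    (hτ.map_mul_comm_of_unitary (stronglyMeasurable_probes r) (norm_probes_le_one hr) hμ
      T.koopman_mem_unitary (hreg.mono fun _ => IsRegular.eventually_star_koopman_probes))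
    fun i => ?_
  have hdiag := actsDiagonally_charOp hreg i
  refine hdiag.map_mul_comm (stronglyMeasurable_probes r) (norm_probes_le_one hr) hτ ?_
  have hstar : star ((T.interval i).indicator 1 : ℝ → ℂ) = (T.interval i).indicator 1 := by
    ext x
    by_cases hx : x ∈ T.interval i <;> simp [hx]
  rwa [hstar, T.charOp_eq_indicatorOp, (isSelfAdjoint_indicatorOp _).star_eq]

theorem IsInvariant.exists_isTracialState (hμ : T.IsInvariant μ) :
    ∃ τ : T.cstarAlgebra →+ ℝ, IsTracialState τ ∧
      ∀ ⦃s⦄ (hs : T.IsCodedSet s), τ hs.proj = μ.real s := by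
  obtain ⟨r, hr, hregular⟩ := T.exists_isRegular
  have hreg := hregular μ hμ
  obtain ⟨τ, hτ⟩ := exists_isMeanState (μ := μ) (stronglyMeasurable_probes r)
    (norm_probes_le_one hr)
  have hintegral {a : Hilbert →L[ℂ] Hilbert} {g : ℝ → ℂ}
      (ha : ActsDiagonally (probes r) μ a g) : τ a = ∫ x, g x ∂μ :=
    ha.map_eq_integral (stronglyMeasurable_probes r) (norm_probes_le_one hr) hτ
      (hreg.mono fun _ => IsRegular.eventually_norm_probes hr)
  refine ⟨Complex.reLm.toAddMonoidHom.comp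
    (τ.toLinearMap.toAddMonoidHom.comp T.cstarAlgebra.subtype.toAddMonoidHom), ?_, ?_⟩
  · refine ⟨fun a b => ?_, fun a => ?_, ?_⟩
    · exact congrArg Complex.re
        (cstarAlgebra_le_tracialCentralizer hμ.preserving hr hreg hτ b.2 a)
    · exact (Complex.nonneg_iff.1 (hτ.map_star_mul_self_nonneg a)).1
    · have hone : τ 1 = 1 := by simpa using hintegral ActsDiagonally.one
      exact congrArg Complex.re hone
  · intro s hs
    have hmeasure : τ (indicatorOp lebesgue hs.measurableSet) = μ.real s := by
      rw [hintegral (hs.actsDiagonally hμ.preserving hreg), integral_indicator hs.measurableSet]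
      simp
    exact congrArg Complex.re hmeasure

theorem IsStationary.measure_eq_lebesgue (hT : T.IsStationary) (hμ : T.IsInvariant μ)
    {s : Set ℝ} (hs : T.IsCodedSet s) : μ s = lebesgue s := by
  obtain ⟨τ, hτ, hτs⟩ := hμ.exists_isTracialState
  obtain ⟨υ, hυ, hυs⟩ := T.isInvariant_lebesgue.exists_isTracialState
  have h := hT.apply_eq_of_isTracialState hτ hυ hs.isStarProjection_proj
  rw [hτs hs, hυs hs] at h
  exact (measureReal_eq_measureReal_iff).1 h

end InvariantTrace

end IntervalExchange

namespace IntervalExchange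

section Cells

variable {n : ℕ} {T : IntervalExchange n} {x y z : ℝ}

theorem imageLeft_nonneg_and_add_len_le_one (T : IntervalExchange n) (i : Fin n) :
    0 ≤ T.imageLeft i ∧ T.imageLeft i + T.len i ≤ 1 := by
  have hsub : Set.Ico (T.imageLeft i) (T.imageLeft i + T.len i) ⊆ Set.Ico 0 1 := by
    simpa [interval, left, imageLeft, inverse] using! T.inverse.interval_subset_Ico (T.perm i)
  exact (Set.Ico_subset_Ico_iff (lt_add_of_pos_right _ (T.len_pos i))).1 hsub

theorem toFun_mem_Icc (T : IntervalExchange n) (x : ℝ) : T.toFun x ∈ Set.Icc (0 : ℝ) 1 := by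
  by_cases hex : ∃ i, x ∈ T.interval i
  · obtain ⟨i, hi⟩ := hex
    obtain ⟨h0, h1⟩ := T.imageLeft_nonneg_and_add_len_le_one i
    rw [T.toFun_eq i hi, piece]
    split_ifs <;> constructor <;> linarith [hi.1, hi.2]
  · rw [toFun, Finset.sum_eq_zero fun i _ => if_neg fun hi => hex ⟨i, hi⟩]
    exact Set.left_mem_Icc.2 zero_le_one

theorem mem_interval_iff_eq {i j : Fin n} (hx : x ∈ T.interval j) : x ∈ T.interval i ↔ i = j :=
  ⟨fun hi => by_contra fun hne => Set.disjoint_left.1 (T.disjoint_interval hne) hi hx,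
    fun hij => hij ▸ hx⟩

theorem eq_or_uIcc_subset_interval (hx : x ∈ Set.Icc (0 : ℝ) 1) (hy : y ∈ Set.Icc (0 : ℝ) 1)
    (h : ∀ i, x ∈ T.interval i ↔ y ∈ T.interval i) :
    x = y ∨ ∃ i, Set.uIcc x y ⊆ T.interval i := by
  have heq_one {w : ℝ} (hw : w ∈ Set.Icc (0 : ℝ) 1) (hne : ¬∃ i, w ∈ T.interval i) : w = 1 :=
    by_contra fun hw1 => hne (T.exists_mem_interval ⟨hw.1, lt_of_le_of_ne hw.2 hw1⟩)
  by_cases hex : ∃ i, x ∈ T.interval i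
  · obtain ⟨i, hi⟩ := hex
    exact Or.inr ⟨i, Set.ordConnected_Ico.uIcc_subset hi ((h i).1 hi)⟩
  · exact Or.inl ((heq_one hx hex).trans (heq_one hy (by simpa only [h] using hex)).symm)

theorem toFun_mem_uIcc {i : Fin n} (h : Set.uIcc x y ⊆ T.interval i) (hz : z ∈ Set.uIcc x y) :
    T.toFun z ∈ Set.uIcc (T.toFun x) (T.toFun y) := by
  rw [T.toFun_eq i (h hz), T.toFun_eq i (h Set.left_mem_uIcc),
    T.toFun_eq i (h Set.right_mem_uIcc)]
  simp only [piece, Set.mem_uIcc] at hz ⊢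
  split_ifs <;> grind

theorem itinerary_eq_of_mem_uIcc (hx : x ∈ Set.Icc (0 : ℝ) 1) (hy : y ∈ Set.Icc (0 : ℝ) 1)
    (h : T.itinerary x = T.itinerary y) (hz : z ∈ Set.uIcc x y) :
    T.itinerary z = T.itinerary x := by
  funext k
  induction k generalizing x y z with
  | zero =>
    funext i
    rcases eq_or_uIcc_subset_interval hx hy fun i => iff_of_eq (congrFun₂ h 0 i) with
      rfl | ⟨j, hj⟩
    · rw [Set.uIcc_self] at hz
      rw [hz]
    · exact propext ((mem_interval_iff_eq (hj hz)).trans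
        (mem_interval_iff_eq (hj Set.left_mem_uIcc)).symm)
  | succ k ih =>
    change T.itinerary (T.toFun z) k = T.itinerary (T.toFun x) k
    refine ih (y := T.toFun y) (T.toFun_mem_Icc x) (T.toFun_mem_Icc y) (congrArg shift h) ?_
    rcases eq_or_uIcc_subset_interval hx hy fun i => iff_of_eq (congrFun₂ h 0 i) with
      rfl | ⟨j, hj⟩
    · rw [Set.uIcc_self] at hz
      rw [hz]
      exact Set.left_mem_uIcc
    · exact toFun_mem_uIcc hj hz

theorem IsStationary.injOn_itinerary (hn : 2 ≤ n) (hT : T.IsStationary) :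
    Set.InjOn T.itinerary (Set.Ico 0 1) := by
  intro x hx y hy h
  have hsub : Set.Ioo (min x y) (max x y) ⊆ T.itinerary ⁻¹' {T.itinerary x} := fun z hz =>
    itinerary_eq_of_mem_uIcc (Set.Ico_subset_Icc_self hx) (Set.Ico_subset_Icc_self hy) h
      (Set.Ioo_subset_Icc_self hz)
  have hzero := measure_mono_null hsub (hT.lebesgue_itinerary_preimage_singleton hn _)
  rw [lebesgue_Ioo (Set.Ioo_subset_Ico_self.trans (Set.Ico_subset_Ico (le_min hx.1 hy.1)
    (max_le hx.2.le hy.2.le))), max_sub_min_eq_abs, ENNReal.ofReal_eq_zero, abs_nonpos_iff,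
    sub_eq_zero] at hzero
  exact hzero.symm

end Cells

end IntervalExchange

section MapInjective

variable {α β : Type*} [MeasurableSpace α] [StandardBorelSpace α] [MeasurableSpace β]
  [MeasurableSpace.CountablySeparated β]

theorem measure_eq_of_map_eq_of_injOn {μ ν : Measure α} {s : Set α} {f : α → β}
    (hs : MeasurableSet s) (hμ : μ sᶜ = 0) (hν : ν sᶜ = 0) (hf : Measurable f)
    (hinj : Set.InjOn f s) (h : μ.map f = ν.map f) : μ = ν := by
  have hmap {m : Measure α} (hm : m sᶜ = 0) {t : Set α} (ht : MeasurableSet t) :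
      m t = m.map f (f '' (t ∩ s)) := by
    rw [Measure.map_apply hf ((ht.inter hs).image_of_measurable_injOn hf
      (hinj.mono Set.inter_subset_right)), ← measure_inter_conull hm,
      ← measure_inter_conull (s := f ⁻¹' (f '' (t ∩ s))) hm,
      hinj.preimage_image_inter Set.inter_subset_right]
  ext t ht
  rw [hmap hμ ht, hmap hν ht, h]

end MapInjective

namespace IntervalExchange

section Uniqueness

variable {n : ℕ} {T : IntervalExchange n} {μ : Measure ℝ} [IsProbabilityMeasure μ]

theorem IsCodedSet.iterate {s : Set ℝ} (hs : T.IsCodedSet s) (k : ℕ) :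
    T.IsCodedSet (T.toFun^[k] ⁻¹' s) := by
  induction k with
  | zero => exact hs
  | succ k ih => exact ih.preimage

/-- The measurable sets of codings whose inverse image under the coding map is a coded set. -/
def codedCylinders (T : IntervalExchange n) : Set (Set (ℕ → Fin n → Prop)) :=
  {t | MeasurableSet t ∧ T.IsCodedSet (T.itinerary ⁻¹' t)}

theorem isPiSystem_codedCylinders : IsPiSystem (codedCylinders T) := fun _ hs _ ht _ =>
  ⟨hs.1.inter ht.1, hs.2.inter ht.2⟩

theorem generateFrom_codedCylinders :
    MeasurableSpace.pi = MeasurableSpace.generateFrom (codedCylinders T) := by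
  refine le_antisymm ?_ (MeasurableSpace.generateFrom_le fun t ht => ht.1)
  have hcoord (k : ℕ) (i : Fin n) : {c : ℕ → Fin n → Prop | c k i} ∈ codedCylinders T :=
    ⟨measurable_mem.1 ((measurable_pi_apply i).comp (measurable_pi_apply k)),
      (IsCodedSet.interval i).iterate k⟩
  refine iSup_le fun k => Measurable.comap_le (@measurable_pi_lambda _ _ _ (_) _ _ fun i =>
    @measurable_to_prop _ (_) _ ?_)
  rw [Set.preimage_singleton_true]
  exact MeasurableSpace.measurableSet_generateFrom (hcoord k i)

theorem IsStationary.map_itinerary_eq (hT : T.IsStationary) (hμ : T.IsInvariant μ) :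
    μ.map T.itinerary = lebesgue.map T.itinerary := by
  have := Measure.isProbabilityMeasure_map (μ := μ) T.measurable_itinerary.aemeasurable
  refine ext_of_generate_finite _ generateFrom_codedCylinders (isPiSystem_codedCylinders (T := T))
    (fun t ht => ?_) ?_
  · rw [Measure.map_apply T.measurable_itinerary ht.1,
      Measure.map_apply T.measurable_itinerary ht.1, hT.measure_eq_lebesgue hμ ht.2]
  · simp [Measure.map_apply T.measurable_itinerary]

end Uniqueness

end IntervalExchange

theorem theorem2 {n : ℕ} (hn : 2 ≤ n) (T : IntervalExchange n) (hT : T.IsStationary) :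
    T.StrictlyErgodic := by
  refine ⟨IntervalExchange.lebesgue, ⟨inferInstance, T.isInvariant_lebesgue⟩, ?_⟩
  rintro μ ⟨_, hμ⟩
  exact measure_eq_of_map_eq_of_injOn measurableSet_Ico hμ.carrier T.isInvariant_lebesgue.carrier
    T.measurable_itinerary (hT.injOn_itinerary hn) (hT.map_itinerary_eq hμ)
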